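/- Let $n\in\mathbb N$, let $\mathcal A$ be a finite non-empty family of real symmetric $n\times n$ matrices, let $g:\mathbb R^{n\times n}\to\mathbb R$ be an arbitrary function, and let $X=(X_1,\dots,X_n)$ be a random vector with independent real components such that $|X_i|\le K$ almost surely for all $i$. Put $$Z=\sup_{A\in\mathcal A}\bigl(X^\top A X-g(A)\bigr)$$ (the choice $g(A)=\mathbb E\,X^\top A X$ gives $Z_{\mathcal A}(X)=\sup_{A\in\mathcal A}(X^\top AX-\mathbb E X^\top AX)$). Let $\|\cdot\|$ denote the Euclidean norm of vectors and the corresponding operator norm of matrices, and let $\mathrm{Diag}(A)$ be the diagonal matrix with the same diagonal as $A$; the diagonals of the matrices in $\mathcal A$ need not vanish. (1) There is an absolute constant $C>0$ such that, if in addition $\mathbb E X_i=0$ for all $i$, then for every $t\ge 1$, with probability at least $1-e^{-t}$, $$Z-\mathbb E Z\le C\Bigl(K\,\mathbb E\sup_{A\in\mathcal A}\|AX\|\,\sqrt t+K^2\sup_{A\in\mathcal A}\|A\|\,t\Bigr).$$ (2) There is an absolute constant $C>0$ such that, without assuming that the $X_i$ are centered, for every $t\ge 1$, with probability at least $1-e^{-t}$,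 $$Z-\mathbb E Z\le C\Bigl(K\bigl(\mathbb E\sup_{A\in\mathcal A}\|AX\|+\mathbb E\sup_{A\in\mathcal A}\|\mathrm{Diag}(A)X\|\bigr)\sqrt t+K^2\sup_{A\in\mathcal A}\|A\|\,t\Bigr).$$ -/

import Mathlib

open MeasureTheory ProbabilityTheory

open scoped Matrix

noncomputable section

/-- The random variable `Z = sup_{A ∈ 𝒜} (Xᵀ A X - g A)` for a finite nonempty family `𝒜`,
evaluated at the value `x` of the random vector `X`. -/
def supQuadForm {n : ℕ} (𝒜 : Finset (Matrix (Fin n) (Fin n) ℝ)) (h𝒜 : 𝒜.Nonempty)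
    (g : Matrix (Fin n) (Fin n) ℝ → ℝ) (x : Fin n → ℝ) : ℝ :=
  𝒜.sup' h𝒜 (fun A => x ⬝ᵥ A *ᵥ x - g A)

/-- The Euclidean norm of the vector `A x`. -/
def normMulVec {n : ℕ} (A : Matrix (Fin n) (Fin n) ℝ) (x : Fin n → ℝ) : ℝ :=
  ‖WithLp.toLp 2 (A *ᵥ x)‖

/-- `sup_{A ∈ 𝒜} ‖A x‖`, with the Euclidean norm. -/
def supNormMulVec {n : ℕ} (𝒜 : Finset (Matrix (Fin n) (Fin n) ℝ)) (h𝒜 : 𝒜.Nonempty)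
    (x : Fin n → ℝ) : ℝ :=
  𝒜.sup' h𝒜 (fun A => normMulVec A x)

/-- `Diag(A)`: the diagonal matrix with the same diagonal as `A`. -/
def diagPart {n : ℕ} (A : Matrix (Fin n) (Fin n) ℝ) : Matrix (Fin n) (Fin n) ℝ :=
  Matrix.diagonal A.diag

/-- `sup_{A ∈ 𝒜} ‖Diag(A) x‖`, with the Euclidean norm. -/
def supNormDiagMulVec {n : ℕ} (𝒜 : Finset (Matrix (Fin n) (Fin n) ℝ)) (h𝒜 : 𝒜.Nonempty)
    (x : Fin n → ℝ) : ℝ :=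
  𝒜.sup' h𝒜 (fun A => normMulVec (diagPart A) x)

/-- `sup_{A ∈ 𝒜} ‖A‖`, with the operator norm of `A` acting on Euclidean space. -/
def supOpNorm {n : ℕ} (𝒜 : Finset (Matrix (Fin n) (Fin n) ℝ)) (h𝒜 : 𝒜.Nonempty) : ℝ :=
  𝒜.sup' h𝒜 (fun A => ‖Matrix.toEuclideanCLM (n := Fin n) (𝕜 := ℝ) A‖)

end

open Filter Topology

/-! The proof is by the entropy method. For `f` of independent coordinates let V(f)(x) be the sum
over i of the mean of (f(x) - f(x'))₊², where x' is x with coordinate i resampled. Tensorization and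
symmetrization of entropy give Ent(e^{lf}) ≤ l² E[V(f) e^{lf}] for l ≥ 0 (`expEntropy_pi_smul_le`),
and the Herbst argument (`cgf_le_of_expEntropy_le`) integrates this to a bound on the cumulant
generating function.

Let A attain the supremum Z at x. Resampling one coordinate changes the form of A by a linear term
in (Ax)_i and a quadratic term in A_ii, so V(Z) ≤ 32K²(2R² + E R²), where R is the supremum of ‖Bx‖
over the family enlarged by its diagonal parts. This bound is random, but R² is self-bounding: V(R²)
≤ 16K²L²R², with L bounding the operator norms. Hence R² has an exponential moment, and the Gibbs
variational inequality trades E[R² e^{lZ}] for a multiple of Ent(e^{lZ}), absorbed for small l, plus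
a multiple of E R² · E e^{lZ} (`measureReal_sub_integral_le_of_self_bounding`). Since V(R) ≤ 16K²L²
as well, E R² is at most 2(E R)² plus a multiple of K²L². This gives part (2).

Part (1) follows because, for centered X, E sup ‖Diag(A)X‖ ≤ 2 E sup ‖AX‖
(`integral_supNormDiagMulVec_le`): Diag(A) is an average of A conjugated by random signs, and
Jensen's inequality removes the signs.

The work takes place on the compact box [-K, K]^n, where continuity alone gives integrability. -/

theorem integrable_of_continuous_compact {α : Type*} [TopologicalSpace α] [CompactSpace α]
    [MeasurableSpace α] [OpensMeasurableSpace α] {μ : Measure α} [IsFiniteMeasure μ]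
    {f : α → ℝ} (hf : Continuous f) : Integrable f μ :=
  hf.integrable_of_hasCompactSupport (HasCompactSupport.of_compactSpace f)

/-- The entropy `Ent(e^h) = E[h e^h] - E[e^h] log E[e^h]`. -/
noncomputable def expEntropy {α : Type*} [MeasurableSpace α] (μ : Measure α) (h : α → ℝ) : ℝ :=
  ∫ x, h x * Real.exp (h x) ∂μ - (∫ x, Real.exp (h x) ∂μ) * Real.log (∫ x, Real.exp (h x) ∂μ)

/-! ### Entropy: variational inequality, tensorization, modified log-Sobolev inequality. -/

section Entropy

set_option linter.unusedSectionVars false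

variable {α β : Type*} [TopologicalSpace α] [CompactSpace α] [T2Space α]
  [SecondCountableTopology α] [MeasurableSpace α] [BorelSpace α]
  [TopologicalSpace β] [CompactSpace β] [T2Space β]
  [SecondCountableTopology β] [MeasurableSpace β] [BorelSpace β]

theorem integral_exp_pos_of_continuous (μ : Measure α) [IsProbabilityMeasure μ] {h : α → ℝ}
    (hh : Continuous h) : 0 < ∫ x, Real.exp (h x) ∂μ :=
  integral_exp_pos (integrable_of_continuous_compact (by fun_prop))

theorem continuous_integral_of_continuous (μ : Measure α) [IsFiniteMeasure μ] {F : β → α → ℝ}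
    (hF : Continuous F.uncurry) : Continuous (fun y => ∫ a, F y a ∂μ) := by
  have := continuous_parametric_integral_of_continuous (μ := μ) hF (isCompact_univ (X := α))
  simpa using this

/-- The Gibbs variational inequality. -/
theorem integral_exp_mul_le_expEntropy_add (μ : Measure α) [IsProbabilityMeasure μ]
    {h g : α → ℝ} (hh : Continuous h) (hg : Continuous g) :
    ∫ x, Real.exp (h x) * g x ∂μ ≤
      expEntropy μ h + (∫ x, Real.exp (h x) ∂μ) * Real.log (∫ x, Real.exp (g x) ∂μ) := by
  unfold expEntropy
  set F := ∫ x, Real.exp (h x) ∂μ with hF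
  set G := ∫ x, Real.exp (g x) ∂μ with hG
  have hFp : 0 < F := integral_exp_pos_of_continuous μ hh
  have hGp : 0 < G := integral_exp_pos_of_continuous μ hg
  -- This is 1 + u ≤ e^u at the log-ratio u of the normalized densities e^g/G and e^h/F, multiplied
  -- by e^h.
  have hpt : ∀ x, Real.exp (h x) * g x ≤ h x * Real.exp (h x) - Real.exp (h x) * Real.log F
      + Real.exp (h x) * Real.log G + (Real.exp (g x) * (F / G) - Real.exp (h x)) := by
    intro x
    have h1 := Real.add_one_le_exp ((g x - Real.log G) - (h x - Real.log F))
    have h2 : Real.exp (h x) * Real.exp ((g x - Real.log G) - (h x - Real.log F))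
        = Real.exp (g x) * (F / G) := by
      rw [← Real.exp_add,
        show h x + (g x - Real.log G - (h x - Real.log F)) = g x + Real.log F - Real.log G by ring,
        Real.exp_sub, Real.exp_add, Real.exp_log hFp, Real.exp_log hGp]
      ring
    have h3 := mul_le_mul_of_nonneg_left h1 (Real.exp_pos (h x)).le
    rw [h2] at h3
    linarith
  have i1 : Integrable (fun x => Real.exp (h x) * g x) μ :=
    integrable_of_continuous_compact (by fun_prop)
  have i2 : Integrable (fun x => h x * Real.exp (h x)) μ :=
    integrable_of_continuous_compact (by fun_prop)
  have i3 : Integrable (fun x => Real.exp (h x)) μ :=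
    integrable_of_continuous_compact (by fun_prop)
  have i4 : Integrable (fun x => Real.exp (g x)) μ :=
    integrable_of_continuous_compact (by fun_prop)
  calc _ ≤ ∫ x, (h x * Real.exp (h x) - Real.exp (h x) * Real.log F
      + Real.exp (h x) * Real.log G + (Real.exp (g x) * (F / G) - Real.exp (h x))) ∂μ :=
        integral_mono i1 (integrable_of_continuous_compact (by fun_prop)) hpt
    _ = _ := by
        rw [integral_add (by fun_prop) (by fun_prop), integral_add (by fun_prop) (by fun_prop),
          integral_sub (by fun_prop) (by fun_prop), integral_sub (by fun_prop) (by fun_prop),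
          integral_mul_const, integral_mul_const, integral_mul_const, ← hF, ← hG]
        field_simp
        ring

theorem continuous_expEntropy_section (μ : Measure α) [IsProbabilityMeasure μ] {h : β → α → ℝ}
    (hh : Continuous h.uncurry) : Continuous (fun y => expEntropy μ (h y)) := by
  have hc : ∀ y, Continuous (h y) := fun y => hh.comp (Continuous.prodMk_right y)
  have h1 : Continuous (fun y => ∫ x, h y x * Real.exp (h y x) ∂μ) :=
    continuous_integral_of_continuous (F := fun y x => h y x * Real.exp (h y x)) μ
      (hh.mul (Real.continuous_exp.comp hh))
  have h2 : Continuous (fun y => ∫ x, Real.exp (h y x) ∂μ) :=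
    continuous_integral_of_continuous (F := fun y x => Real.exp (h y x)) μ
      (Real.continuous_exp.comp hh)
  exact h1.sub (h2.mul (h2.log fun y => (integral_exp_pos_of_continuous μ (hc y)).ne'))

/-- Subadditivity of entropy on a product of two spaces. -/
theorem expEntropy_prod_le (μ : Measure α) [IsProbabilityMeasure μ] (ν : Measure β)
    [IsProbabilityMeasure ν] {h : α × β → ℝ} (hh : Continuous h) :
    expEntropy (μ.prod ν) h ≤ ∫ y, expEntropy μ (fun a => h (a, y)) ∂ν
      + ∫ a, expEntropy ν (fun y => h (a, y)) ∂μ := by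
  set f₁ : β → ℝ := fun y => ∫ a, Real.exp (h (a, y)) ∂μ with hf₁
  have hf₁c : Continuous f₁ :=
    continuous_integral_of_continuous (F := fun y a => Real.exp (h (a, y))) μ (by fun_prop)
  have hf₁p : ∀ y, 0 < f₁ y := fun y => integral_exp_pos_of_continuous μ (by fun_prop)
  -- Entropy is exactly the mean fibre entropy over μ plus the entropy of the marginal f₁. The
  -- latter is bounded by testing the Gibbs inequality on log f₁ in each ν-fibre.
  set h₁ : β → ℝ := fun y => Real.log (f₁ y) with hh₁
  have hh₁c : Continuous h₁ := hf₁c.log fun y => (hf₁p y).ne'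
  have hexp : ∀ y, Real.exp (h₁ y) = f₁ y := fun y => Real.exp_log (hf₁p y)
  set F := ∫ y, f₁ y ∂ν with hF
  have hFeq : ∫ p, Real.exp (h p) ∂(μ.prod ν) = F :=
    integral_prod_symm _ (integrable_of_continuous_compact (by fun_prop))
  have hF2 : ∫ a, ∫ y, Real.exp (h (a, y)) ∂ν ∂μ = F := by
    rw [← hFeq, integral_prod _ (integrable_of_continuous_compact (by fun_prop))]
  have hgib : ∀ a, ∫ y, Real.exp (h (a, y)) * h₁ y ∂ν ≤ expEntropy ν (fun y => h (a, y))
      + (∫ y, Real.exp (h (a, y)) ∂ν) * Real.log F := by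
    intro a
    have := integral_exp_mul_le_expEntropy_add ν (h := fun y => h (a, y)) (by fun_prop) hh₁c
    simpa only [hexp] using this
  have cE : Continuous (fun a => expEntropy ν (fun y => h (a, y))) :=
    continuous_expEntropy_section ν (h := fun a y => h (a, y)) (by fun_prop)
  have cI : Continuous (fun a => ∫ y, Real.exp (h (a, y)) ∂ν) :=
    continuous_integral_of_continuous (F := fun a y => Real.exp (h (a, y))) ν (by fun_prop)
  have cG : Continuous (fun a => ∫ y, Real.exp (h (a, y)) * h₁ y ∂ν) :=
    continuous_integral_of_continuous (F := fun a y => Real.exp (h (a, y)) * h₁ y) ν (by fun_prop)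
  have hint : ∫ a, ∫ y, Real.exp (h (a, y)) * h₁ y ∂ν ∂μ
      ≤ ∫ a, expEntropy ν (fun y => h (a, y)) ∂μ + F * Real.log F := by
    calc _ ≤ ∫ a, (expEntropy ν (fun y => h (a, y))
          + (∫ y, Real.exp (h (a, y)) ∂ν) * Real.log F) ∂μ :=
          integral_mono (integrable_of_continuous_compact cG)
            (integrable_of_continuous_compact (by fun_prop)) hgib
      _ = _ := by
          rw [integral_add (integrable_of_continuous_compact cE)
            (integrable_of_continuous_compact (by fun_prop)), integral_mul_const, hF2]
  have hswap : ∫ a, ∫ y, Real.exp (h (a, y)) * h₁ y ∂ν ∂μ = ∫ y, f₁ y * h₁ y ∂ν := by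
    rw [integral_integral_swap (integrable_of_continuous_compact
      (f := fun p : α × β => Real.exp (h (p.1, p.2)) * h₁ p.2) (by fun_prop))]
    simp only [integral_mul_const, hf₁]
  have hfirst : ∫ y, expEntropy μ (fun a => h (a, y)) ∂ν
      = ∫ p, h p * Real.exp (h p) ∂(μ.prod ν) - ∫ y, f₁ y * h₁ y ∂ν := by
    rw [integral_prod_symm _ (integrable_of_continuous_compact (by fun_prop)), ← integral_sub]
    · rfl
    · exact integrable_of_continuous_compact (continuous_integral_of_continuous
        (F := fun y a => h (a, y) * Real.exp (h (a, y))) μ (by fun_prop))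
    · exact integrable_of_continuous_compact (by fun_prop)
  unfold expEntropy at hfirst ⊢
  rw [hfirst, hFeq]
  unfold expEntropy at hint
  linarith

/-- The modified logarithmic Sobolev inequality on a single probability space. -/
theorem expEntropy_le_integral_sq_pos_part (μ : Measure α) [IsProbabilityMeasure μ] {h : α → ℝ}
    (hh : Continuous h) :
    expEntropy μ h ≤ ∫ a, (∫ s, (max (h a - h s) 0) ^ 2 ∂μ) * Real.exp (h a) ∂μ := by
  set u : α × α → ℝ := fun p => Real.exp (h p.1) * (h p.1 - h p.2) with hu
  set q : α × α → ℝ := fun p => (max (h p.1 - h p.2) 0) ^ 2 * Real.exp (h p.1) with hq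
  have cu : Continuous u := by fun_prop
  have cq : Continuous q := by fun_prop
  -- After pairing (a, s) with (s, a) the claim is (e^b - e^a)(b - a) ≤ (b - a)² e^b for a ≤ b,
  -- which is the tangent line bound for exp.
  have key : ∀ a b : ℝ, a ≤ b → Real.exp b * (b - a) + Real.exp a * (a - b)
      ≤ (max (b - a) 0) ^ 2 * Real.exp b + (max (a - b) 0) ^ 2 * Real.exp a := by
    intro a b hab
    rw [max_eq_left (by linarith), max_eq_right (by linarith)]
    have h1 := Real.add_one_le_exp (a - b)
    have h2 : Real.exp b * Real.exp (a - b) = Real.exp a := by rw [← Real.exp_add]; ring_nf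
    have h3 := mul_le_mul_of_nonneg_left h1 (Real.exp_pos b).le
    rw [h2] at h3
    nlinarith [mul_le_mul_of_nonneg_right h3 (sub_nonneg.2 hab)]
  have hpt : ∀ p, u p + u p.swap ≤ q p + q p.swap := by
    rintro ⟨a, b⟩
    rcases le_total (h b) (h a) with hab | hab
    · exact key _ _ hab
    · have := key _ _ hab
      simp only [hu, hq, Prod.swap]
      linarith
  have iu : Integrable u (μ.prod μ) := integrable_of_continuous_compact cu
  have iq : Integrable q (μ.prod μ) := integrable_of_continuous_compact cq
  have hle : ∫ p, u p ∂(μ.prod μ) ≤ ∫ p, q p ∂(μ.prod μ) := by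
    have := integral_mono (μ := μ.prod μ) (f := fun p => u p + u p.swap)
      (g := fun p => q p + q p.swap) (iu.add iu.swap) (iq.add iq.swap) hpt
    have a1 := integral_add iu iu.swap
    have a2 := integral_add iq iq.swap
    simp only [Function.comp_apply] at a1 a2
    rw [a1, a2] at this
    have e1 : ∫ p, u p.swap ∂(μ.prod μ) = ∫ p, u p ∂(μ.prod μ) := integral_prod_swap u
    have e2 : ∫ p, q p.swap ∂(μ.prod μ) = ∫ p, q p ∂(μ.prod μ) := integral_prod_swap q
    linarith
  have hqi : ∫ p, q p ∂(μ.prod μ)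
      = ∫ a, (∫ s, (max (h a - h s) 0) ^ 2 ∂μ) * Real.exp (h a) ∂μ := by
    rw [integral_prod _ iq]
    simp only [hq, integral_mul_const]
  have i1 : Integrable h μ := integrable_of_continuous_compact hh
  have i2 : Integrable (fun x => h x * Real.exp (h x)) μ :=
    integrable_of_continuous_compact (by fun_prop)
  have i3 : Integrable (fun x => Real.exp (h x)) μ :=
    integrable_of_continuous_compact (by fun_prop)
  have hui : ∫ p, u p ∂(μ.prod μ)
      = ∫ x, h x * Real.exp (h x) ∂μ - (∫ x, Real.exp (h x) ∂μ) * ∫ x, h x ∂μ := by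
    rw [integral_prod _ iu]
    have : ∀ a, ∫ s, u (a, s) ∂μ = h a * Real.exp (h a) - Real.exp (h a) * ∫ x, h x ∂μ := by
      intro a
      simp only [hu]
      rw [integral_const_mul, integral_sub (integrable_const _) i1]
      simp
      ring
    simp only [this]
    rw [integral_sub i2 (i3.mul_const _), integral_mul_const]
  -- Jensen replaces log E e^h by E h, so the entropy is at most the covariance of h and e^h, which
  -- is the integral of `u`.
  have hjen : ∫ x, h x ∂μ ≤ Real.log (∫ x, Real.exp (h x) ∂μ) := by
    rw [Real.le_log_iff_exp_le (integral_exp_pos_of_continuous μ hh)]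
    exact convexOn_exp.map_integral_le Real.continuous_exp.continuousOn isClosed_univ
      (by simp) i1 i3
  rw [← hqi]
  refine le_trans ?_ hle
  rw [hui]
  unfold expEntropy
  have := mul_le_mul_of_nonneg_left hjen (integral_exp_pos_of_continuous μ hh).le
  linarith

/-- Splitting off coordinate 0 lets induction on the dimension rest on the two-factor subadditivity.
-/
theorem integral_pi_succ {n : ℕ} (μ : Fin (n + 1) → Measure α) [∀ i, IsProbabilityMeasure (μ i)]
    (F : (Fin (n + 1) → α) → ℝ) :
    ∫ x, F x ∂(Measure.pi μ)
      = ∫ p, F (Fin.cons p.1 p.2) ∂((μ 0).prod (Measure.pi fun j => μ j.succ)) := by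
  have h := measurePreserving_piFinSuccAbove μ 0
  have := h.symm.integral_comp' (g := F)
  rw [← this]
  simp only [MeasurableEquiv.piFinSuccAbove_symm_apply, Fin.succAbove_zero]
  congr 1
  ext p
  simp [Fin.insertNthEquiv]

/-- The modified logarithmic Sobolev inequality for product measures. -/
theorem expEntropy_pi_le (n : ℕ) (μ : Fin n → Measure α) [∀ i, IsProbabilityMeasure (μ i)]
    {h : (Fin n → α) → ℝ} (hh : Continuous h) :
    expEntropy (Measure.pi μ) h ≤ ∑ i, ∫ x,
      (∫ s, (max (h x - h (Function.update x i s)) 0) ^ 2 ∂(μ i)) * Real.exp (h x)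
        ∂(Measure.pi μ) := by
  induction n with
  | zero =>
    have : h = fun _ => h default := by ext x; congr 1; exact Subsingleton.elim _ _
    rw [this]
    simp [expEntropy]
    exact (mul_comm _ _).le
  | succ n ih =>
    set ν := Measure.pi fun j : Fin n => μ j.succ with hν
    set k : α × (Fin n → α) → ℝ := fun p => h (Fin.cons p.1 p.2) with hk
    have ck : Continuous k := by
      refine hh.comp (continuous_pi fun i => ?_)
      refine Fin.cases ?_ (fun j => ?_) i <;> simp <;> fun_prop
    have e0 : expEntropy (Measure.pi μ) h = expEntropy ((μ 0).prod ν) k := by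
      simp only [expEntropy, integral_pi_succ, hk, hν]
    rw [e0, Fin.sum_univ_succ]
    refine (expEntropy_prod_le _ _ ck).trans (add_le_add ?_ ?_)
    · rw [integral_pi_succ]
      simp only [Fin.update_cons_zero]
      have c1 : Continuous fun p : α × (Fin n → α) => ∫ s, (max (k p - k (s, p.2)) 0) ^ 2 ∂(μ 0) :=
        continuous_integral_of_continuous
          (F := fun (p : α × (Fin n → α)) s => (max (k p - k (s, p.2)) 0) ^ 2) (μ 0) (by fun_prop)
      change _ ≤ ∫ p, (∫ s, (max (k p - k (s, p.2)) 0) ^ 2 ∂(μ 0)) * Real.exp (k p) ∂((μ 0).prod ν)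
      rw [integral_prod_symm _ (integrable_of_continuous_compact (by fun_prop))]
      refine integral_mono (integrable_of_continuous_compact
        (continuous_expEntropy_section _ (h := fun y a => k (a, y)) (by fun_prop)))
        (integrable_of_continuous_compact (continuous_integral_of_continuous (F := fun y a =>
          (∫ s, (max (k (a, y) - k (s, y)) 0) ^ 2 ∂(μ 0)) * Real.exp (k (a, y))) _ ?_)) ?_
      · have := (c1.comp (continuous_swap)).mul (Real.continuous_exp.comp (ck.comp continuous_swap))
        exact this
      · intro y
        exact expEntropy_le_integral_sq_pos_part (μ 0) (h := fun a => k (a, y)) (by fun_prop)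
    · have c1 : ∀ j : Fin n, Continuous fun p : α × (Fin n → α) =>
          (∫ s, (max (k p - k (p.1, Function.update p.2 j s)) 0) ^ 2 ∂(μ j.succ))
            * Real.exp (k p) := fun j =>
        (continuous_integral_of_continuous (F := fun (p : α × (Fin n → α)) s =>
          (max (k p - k (p.1, Function.update p.2 j s)) 0) ^ 2) _ (by fun_prop)).mul (by fun_prop)
      have e1 : ∀ j : Fin n, ∫ x, (∫ s, (max (h x - h (Function.update x j.succ s)) 0) ^ 2
            ∂(μ j.succ)) * Real.exp (h x) ∂(Measure.pi μ)
          = ∫ a, ∫ y, (∫ s, (max (k (a, y) - k (a, Function.update y j s)) 0) ^ 2 ∂(μ j.succ))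
            * Real.exp (k (a, y)) ∂ν ∂(μ 0) := by
        intro j
        rw [integral_pi_succ, ← integral_prod _ (integrable_of_continuous_compact (c1 j))]
        simp only [← Fin.cons_update, hk, hν]
      simp only [e1]
      have c2 : ∀ j : Fin n, Continuous fun a => ∫ y, (∫ s, (max (k (a, y) -
          k (a, Function.update y j s)) 0) ^ 2 ∂(μ j.succ)) * Real.exp (k (a, y)) ∂ν := fun j =>
        continuous_integral_of_continuous (F := fun a y => (∫ s, (max (k (a, y) -
          k (a, Function.update y j s)) 0) ^ 2 ∂(μ j.succ)) * Real.exp (k (a, y))) _ (c1 j)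
      rw [← integral_finsetSum _ fun j _ => integrable_of_continuous_compact (c2 j)]
      refine integral_mono (integrable_of_continuous_compact
        (continuous_expEntropy_section _ (h := fun a y => k (a, y)) (by fun_prop)))
        (integrable_of_continuous_compact (continuous_finsetSum _ fun j _ => c2 j)) ?_
      intro a
      have := ih (fun j => μ j.succ) (h := fun y => k (a, y)) (by fun_prop)
      exact this

/-- The entropy bound for `l • f` in terms of a pointwise bound `V` on the sum of the squared
positive parts of the one-coordinate increments of `f`. -/
theorem expEntropy_pi_smul_le {n : ℕ} (μ : Fin n → Measure α) [∀ i, IsProbabilityMeasure (μ i)]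
    {f V : (Fin n → α) → ℝ} (hf : Continuous f) (hV : Continuous V)
    (hfV : ∀ x, ∑ i, ∫ s, (max (f x - f (Function.update x i s)) 0) ^ 2 ∂(μ i) ≤ V x)
    {l : ℝ} (hl : 0 ≤ l) :
    expEntropy (Measure.pi μ) (fun x => l * f x)
      ≤ l ^ 2 * ∫ x, V x * Real.exp (l * f x) ∂(Measure.pi μ) := by
  refine (expEntropy_pi_le n μ (h := fun x => l * f x) (by fun_prop)).trans ?_
  have c1 : ∀ i, Continuous fun x =>
      (∫ s, (max (l * f x - l * f (Function.update x i s)) 0) ^ 2 ∂(μ i)) * Real.exp (l * f x) :=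
    fun i => (continuous_integral_of_continuous (F := fun x s =>
      (max (l * f x - l * f (Function.update x i s)) 0) ^ 2) _ (by fun_prop)).mul (by fun_prop)
  rw [← integral_finsetSum _ fun i _ => integrable_of_continuous_compact (c1 i),
    ← integral_const_mul]
  refine integral_mono (integrable_of_continuous_compact (continuous_finsetSum _ fun i _ => c1 i))
    (integrable_of_continuous_compact (by fun_prop)) fun x => ?_
  have e : ∀ i, ∫ s, (max (l * f x - l * f (Function.update x i s)) 0) ^ 2 ∂(μ i)
      = l ^ 2 * ∫ s, (max (f x - f (Function.update x i s)) 0) ^ 2 ∂(μ i) := by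
    intro i
    rw [← integral_const_mul]
    congr 1; ext s
    rw [← mul_sub, ← mul_pow, mul_max_of_nonneg _ _ hl, mul_zero]
  simp only [e, ← Finset.sum_mul, ← Finset.mul_sum]
  rw [← mul_assoc]
  gcongr
  exact hfV x

end Entropy

/-! ### From entropy bounds to deviation bounds. -/

section Herbst

set_option linter.unusedSectionVars false

variable {α : Type*} [TopologicalSpace α] [CompactSpace α] [T2Space α]
  [SecondCountableTopology α] [MeasurableSpace α] [BorelSpace α]

/-- The Herbst argument: a differential inequality for the entropy gives a bound on the
cumulant generating function. -/
theorem cgf_le_of_expEntropy_le (μ : Measure α) [IsProbabilityMeasure μ] {f : α → ℝ}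
    (hf : Continuous f) {v a l₀ : ℝ} (hl₀ : 0 < l₀)
    (hent : ∀ l, 0 < l → l ≤ l₀ → expEntropy μ (fun x => l * f x)
      ≤ l ^ 2 * (v * ∫ x, Real.exp (l * f x) ∂μ + a * ∫ x, f x * Real.exp (l * f x) ∂μ)) :
    cgf f μ l₀ ≤ l₀ * (∫ x, f x ∂μ + v * l₀ + a * cgf f μ l₀) := by
  have hint : ∀ l, l ∈ interior (integrableExpSet f μ) := by
    intro l
    have : integrableExpSet f μ = Set.univ := by
      ext l
      simp only [integrableExpSet, Set.mem_ofPred_eq, Set.mem_univ, iff_true]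
      exact integrable_of_continuous_compact (by fun_prop)
    simp [this]
  have hMpos : ∀ l, 0 < mgf f μ l := fun l =>
    integral_exp_pos_of_continuous μ (h := fun x => l * f x) (by fun_prop)
  have hder : ∀ l, HasDerivAt (cgf f μ)
      ((∫ x, f x * Real.exp (l * f x) ∂μ) / mgf f μ l) l := fun l =>
    (hasDerivAt_mgf (hint l)).log (hMpos l).ne'
  -- The derivative of cgf(l)/l is the entropy of e^{lf} divided by l² times the mgf. The hypothesis
  -- therefore says exactly that `G` is nonincreasing, and `G` tends to the mean of f at 0⁺.
  set G : ℝ → ℝ := fun l => cgf f μ l / l - v * l - a * cgf f μ l with hG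
  have hGder : ∀ l, 0 < l → HasDerivAt G
      ((((∫ x, f x * Real.exp (l * f x) ∂μ) / mgf f μ l) * l - cgf f μ l * 1) / l ^ 2 - v * 1
        - a * ((∫ x, f x * Real.exp (l * f x) ∂μ) / mgf f μ l)) l := by
    intro l hl
    exact (((hder l).div (hasDerivAt_id l) hl.ne').sub ((hasDerivAt_id l).const_mul v)).sub
      ((hder l).const_mul a)
  have hanti : AntitoneOn G (Set.Ioc 0 l₀) := by
    refine antitoneOn_of_deriv_nonpos (convex_Ioc _ _)
      (fun l hl => (hGder l hl.1).continuousAt.continuousWithinAt)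
      (fun l hl => ?_) (fun l hl => ?_)
    · rw [interior_Ioc] at hl
      exact (hGder l hl.1).differentiableAt.differentiableWithinAt
    · rw [interior_Ioc] at hl
      rw [(hGder l hl.1).deriv]
      have h1 := hent l hl.1 hl.2.le
      have hM := hMpos l
      have hl0 := hl.1
      unfold expEntropy at h1
      have e1 : ∫ x, Real.exp (l * f x) ∂μ = mgf f μ l := rfl
      have e2 : ∫ x, l * f x * Real.exp (l * f x) ∂μ = l * ∫ x, f x * Real.exp (l * f x) ∂μ := by
        rw [← integral_const_mul]; simp only [mul_assoc]
      rw [e1, e2] at h1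
      change l * _ - mgf f μ l * cgf f μ l ≤ _ at h1
      set M := mgf f μ l
      set D := ∫ x, f x * Real.exp (l * f x) ∂μ
      have : (D / M * l - cgf f μ l * 1) / l ^ 2 - v * 1 - a * (D / M)
          = (l * D - M * cgf f μ l - l ^ 2 * (v * M + a * D)) / (M * l ^ 2) := by
        field_simp
        ring
      rw [this]
      exact div_nonpos_of_nonpos_of_nonneg (by linarith) (by positivity)
  have hlim : Tendsto G (𝓝[>] 0) (𝓝 (∫ x, f x ∂μ)) := by
    have h0 := hder 0
    have hs := h0.tendsto_slope_zero_right
    have e : (∫ x, f x * Real.exp (0 * f x) ∂μ) / mgf f μ 0 = ∫ x, f x ∂μ := by simp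
    rw [e] at hs
    have hc : Tendsto (fun l => v * l + a * cgf f μ l) (𝓝[>] 0) (𝓝 0) := by
      have : ContinuousAt (fun l => v * l + a * cgf f μ l) 0 :=
        (continuousAt_id.const_mul v).add (h0.continuousAt.const_mul a)
      have h2 := this.tendsto.mono_left (nhdsWithin_le_nhds (s := Set.Ioi 0))
      simpa using h2
    have := hs.sub hc
    simp only [sub_zero] at this
    refine this.congr fun l => ?_
    simp [hG, div_eq_inv_mul]
    ring
  have hle : G l₀ ≤ ∫ x, f x ∂μ := by
    refine ge_of_tendsto hlim ?_
    filter_upwards [Ioc_mem_nhdsGT hl₀] with l hl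
    exact hanti hl ⟨hl₀, le_rfl⟩ hl.2
  have : cgf f μ l₀ = l₀ * (G l₀ + v * l₀ + a * cgf f μ l₀) := by
    simp only [hG]; field_simp; ring
  have h3 := mul_le_mul_of_nonneg_left hle hl₀.le
  rw [mul_add, mul_add] at this ⊢
  linarith

/-- The Chernoff bound for a random variable with a sub-gamma cumulant generating function. -/
theorem measureReal_sub_integral_le_of_cgf_le (μ : Measure α) [IsProbabilityMeasure μ] {f : α → ℝ}
    (hf : Continuous f) {v l₀ t : ℝ} (hl₀ : 0 < l₀) (hv : 0 < v) (ht : 0 < t)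
    (hcgf : ∀ l, 0 < l → l ≤ l₀ → cgf f μ l ≤ l * (∫ x, f x ∂μ + v * l)) :
    1 - Real.exp (-t) ≤
      μ.real {x | f x - ∫ y, f y ∂μ ≤ 2 * Real.sqrt (v * t) + 2 * t / l₀} := by
  set s := 2 * Real.sqrt (v * t) + 2 * t / l₀ with hs
  set m := ∫ y, f y ∂μ with hm
  -- The Chernoff exponent is optimized up to constants by l = √(t/v); if this exceeds l₀, the
  -- endpoint l₀ suffices.
  have key : ∃ l, 0 < l ∧ l ≤ l₀ ∧ v * l ^ 2 - l * s ≤ -t := by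
    have hsq : 0 ≤ Real.sqrt (v * t) := Real.sqrt_nonneg _
    rcases le_total l₀ (Real.sqrt (t / v)) with h | h
    · refine ⟨l₀, hl₀, le_rfl, ?_⟩
      have h1 : l₀ ^ 2 ≤ t / v := by
        rw [← Real.sq_sqrt (div_pos ht hv).le]; gcongr
      have h2 : v * l₀ ^ 2 ≤ t := by
        rw [le_div_iff₀ hv] at h1; linarith
      have h3 : l₀ * s = 2 * (l₀ * Real.sqrt (v * t)) + 2 * t := by
        rw [hs]; field_simp
      have := mul_nonneg hl₀.le hsq
      linarith
    · refine ⟨Real.sqrt (t / v), Real.sqrt_pos.2 (div_pos ht hv), h, ?_⟩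
      have h1 : Real.sqrt (t / v) * Real.sqrt (v * t) = t := by
        rw [← Real.sqrt_mul (div_pos ht hv).le, show t / v * (v * t) = t ^ 2 by field_simp,
          Real.sqrt_sq ht.le]
      have h2 : v * Real.sqrt (t / v) ^ 2 = t := by
        rw [Real.sq_sqrt (div_pos ht hv).le]; field_simp
      have h3 : 0 ≤ Real.sqrt (t / v) * (2 * t / l₀) := by positivity
      rw [h2, hs]
      nlinarith
  obtain ⟨l, hl, hll, hlt⟩ := key
  have hch := measure_ge_le_exp_cgf (μ := μ) (X := f) (m + s) hl.le
    (integrable_of_continuous_compact (by fun_prop))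
  have hle : Real.exp (-l * (m + s) + cgf f μ l) ≤ Real.exp (-t) := by
    apply Real.exp_le_exp.2
    have := hcgf l hl hll
    nlinarith
  have hmeas : MeasurableSet {x | f x - m ≤ s} :=
    (isClosed_le (by fun_prop) (by fun_prop)).measurableSet
  have hcompl : μ.real {x | f x - m ≤ s}ᶜ ≤ μ.real {ω | m + s ≤ f ω} := by
    refine measureReal_mono fun x hx => ?_
    simp only [Set.mem_compl_iff, Set.mem_ofPred_eq, not_le] at hx ⊢
    linarith
  rw [probReal_compl_eq_one_sub hmeas] at hcompl
  linarith

end Herbst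

/-! ### Self-bounding functions on product spaces. -/

section Product

variable {α : Type*} [TopologicalSpace α] [CompactSpace α] [T2Space α]
  [SecondCountableTopology α] [MeasurableSpace α] [BorelSpace α]

/-- A self-bounding estimate: `V(f) ≤ a f` controls the exponential moment of `f`. -/
theorem cgf_le_of_self_bounding {n : ℕ} (μ : Fin n → Measure α) [∀ i, IsProbabilityMeasure (μ i)]
    {f : (Fin n → α) → ℝ} (hf : Continuous f) {a : ℝ} (ha : 0 < a)
    (hfV : ∀ x, ∑ i, ∫ s, (max (f x - f (Function.update x i s)) 0) ^ 2 ∂(μ i) ≤ a * f x) :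
    cgf f (Measure.pi μ) (1 / (2 * a)) ≤ (∫ x, f x ∂(Measure.pi μ)) / a := by
  -- At l₀ = 1/(2a) the cgf on the right has coefficient l₀a = 1/2 and is absorbed on the left.
  have h := cgf_le_of_expEntropy_le (Measure.pi μ) hf (v := 0) (a := a)
    (l₀ := 1 / (2 * a)) (by positivity) (fun l hl _ => by
      have := expEntropy_pi_smul_le μ hf (V := fun x => a * f x) (by fun_prop) hfV hl.le
      simp only [mul_assoc, integral_const_mul] at this ⊢
      simpa using this)
  set c := cgf f (Measure.pi μ) (1 / (2 * a))
  set m := ∫ x, f x ∂(Measure.pi μ)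
  have e : 1 / (2 * a) * (m + 0 * (1 / (2 * a)) + a * c) = m / (2 * a) + c / 2 := by
    field_simp; ring
  rw [e] at h
  have : m / a = 2 * (m / (2 * a)) := by field_simp
  linarith

/-- `V(f) ≤ a` bounds the second moment of a nonnegative `f` by its first moment. -/
theorem integral_sq_le_of_bounded_differences {n : ℕ} (μ : Fin n → Measure α)
    [∀ i, IsProbabilityMeasure (μ i)]
    {f : (Fin n → α) → ℝ} (hf : Continuous f) (hf0 : ∀ x, 0 ≤ f x) {a : ℝ} (ha : 0 < a)
    (hfV : ∀ x, ∑ i, ∫ s, (max (f x - f (Function.update x i s)) 0) ^ 2 ∂(μ i) ≤ a) :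
    ∫ x, f x ^ 2 ∂(Measure.pi μ) ≤ 2 * (∫ x, f x ∂(Measure.pi μ)) ^ 2 + 12 * a := by
  set π := Measure.pi μ
  set m := ∫ x, f x ∂π
  set l := 1 / Real.sqrt a with hl
  have hsa : 0 < Real.sqrt a := Real.sqrt_pos.2 ha
  have hl0 : 0 < l := by positivity
  have hla : l ^ 2 * a = 1 := by
    rw [hl, div_pow, Real.sq_sqrt ha.le]; field_simp
  have h := cgf_le_of_expEntropy_le π hf (v := a) (a := 0) (l₀ := l) hl0 (fun l hl _ => by
      have := expEntropy_pi_smul_le μ hf (V := fun _ => a) (by fun_prop) hfV hl.le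
      simpa only [integral_const_mul, zero_mul, add_zero] using this)
  have h1 : cgf f π l ≤ l * m + 1 := by nlinarith
  have hM : ∫ x, Real.exp (l * f x) ∂π ≤ Real.exp (l * m + 1) := by
    have hp := integral_exp_pos_of_continuous π (h := fun x => l * f x) (by fun_prop)
    exact (Real.log_le_iff_le_exp hp).1 h1
  -- Above the mean, with u = f - m, use (m + u)² ≤ 2m² + 2u² and (lu)² ≤ 2e^{lu}. Integration then
  -- costs 4a·e ≤ 12a.
  have hpt : ∀ x, f x ^ 2 ≤ 2 * m ^ 2 + 4 * a * (Real.exp (l * f x) * Real.exp (-(l * m))) := by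
    intro x
    rw [← Real.exp_add]
    have hm0 : 0 ≤ m := integral_nonneg hf0
    rcases le_total (f x) m with hc | hc
    · have : f x ^ 2 ≤ m ^ 2 := by gcongr; exact hf0 x
      have h2 : 0 ≤ 4 * a * Real.exp (l * f x + -(l * m)) := by positivity
      nlinarith [sq_nonneg m]
    · set u := f x - m
      have hu : 0 ≤ u := sub_nonneg.2 hc
      have h2 := Real.quadratic_le_exp_of_nonneg (mul_nonneg hl0.le hu)
      have h3 : l * f x + -(l * m) = l * u := by simp only [u]; ring
      rw [h3]
      have h4 : (l * u) ^ 2 ≤ 2 * Real.exp (l * u) := by nlinarith [mul_nonneg hl0.le hu]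
      have h5 : u ^ 2 ≤ 2 * a * Real.exp (l * u) := by
        have := mul_le_mul_of_nonneg_left h4 ha.le
        have e : a * (l * u) ^ 2 = u ^ 2 := by
          rw [mul_pow, ← mul_assoc, mul_comm a, hla, one_mul]
        nlinarith
      have h6 : f x = m + u := by simp only [u]; ring
      rw [h6]
      nlinarith [sq_nonneg (m - u)]
  calc _ ≤ ∫ x, (2 * m ^ 2 + 4 * a * (Real.exp (l * f x) * Real.exp (-(l * m)))) ∂π :=
        integral_mono (integrable_of_continuous_compact (by fun_prop))
          (integrable_of_continuous_compact (by fun_prop)) hpt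
    _ = 2 * m ^ 2 + 4 * a * ((∫ x, Real.exp (l * f x) ∂π) * Real.exp (-(l * m))) := by
        rw [integral_add (integrable_of_continuous_compact (by fun_prop))
          (integrable_of_continuous_compact (by fun_prop)), integral_const_mul (4 * a)]
        simp [integral_mul_const]
    _ ≤ 2 * m ^ 2 + 4 * a * (Real.exp (l * m + 1) * Real.exp (-(l * m))) := by gcongr
    _ ≤ _ := by
        rw [← Real.exp_add, show l * m + 1 + -(l * m) = 1 by ring]
        have := Real.exp_one_lt_d9
        nlinarith

/-- Concentration of `f` when `V(f) ≤ b (2 q + E q)` with `q` self-bounding. -/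
theorem measureReal_sub_integral_le_of_self_bounding {n : ℕ} (μ : Fin n → Measure α)
    [∀ i, IsProbabilityMeasure (μ i)]
    {f q : (Fin n → α) → ℝ} (hf : Continuous f) (hq : Continuous q) (hq0 : ∀ x, 0 ≤ q x)
    {a b w t : ℝ} (ha : 0 < a) (hb : 0 < b) (ht : 0 < t) (hw : 0 < w)
    (hqV : ∀ x, ∑ i, ∫ s, (max (q x - q (Function.update x i s)) 0) ^ 2 ∂(μ i) ≤ a * q x)
    (hqw : ∫ x, q x ∂(Measure.pi μ) ≤ w)
    (hfV : ∀ x, ∑ i, ∫ s, (max (f x - f (Function.update x i s)) 0) ^ 2 ∂(μ i)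
      ≤ b * (2 * q x + ∫ y, q y ∂(Measure.pi μ))) :
    1 - Real.exp (-t) ≤ (Measure.pi μ).real {x | f x - ∫ y, f y ∂(Measure.pi μ)
      ≤ 2 * Real.sqrt (10 * b * w * t) + 2 * t * Real.sqrt (8 * a * b)} := by
  set π := Measure.pi μ
  set m := ∫ x, q x ∂π with hm
  have hab : 0 < Real.sqrt (8 * a * b) := Real.sqrt_pos.2 (by positivity)
  have hm0 : 0 ≤ m := integral_nonneg hq0
  have hψ := cgf_le_of_self_bounding μ hq ha hqV
  have main := measureReal_sub_integral_le_of_cgf_le π hf (v := 10 * b * w)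
    (l₀ := 1 / Real.sqrt (8 * a * b)) (t := t) (by positivity) (by positivity) ht ?_
  · simpa only [div_div_eq_mul_div, div_one] using main
  intro l₀ hl₀ hl₀'
  have h := cgf_le_of_expEntropy_le π hf (v := 10 * b * w) (a := 0) hl₀ ?_
  · simpa using h
  intro l hl hll
  -- The range of l is chosen so that 4ab·l² ≤ 1/2, which allows the entropy term in `h5` to be
  -- absorbed.
  have hl2 : l ^ 2 * (8 * a * b) ≤ 1 := by
    have : l ≤ 1 / Real.sqrt (8 * a * b) := hll.trans hl₀'
    rw [le_div_iff₀ hab] at this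
    have h2 : (l * Real.sqrt (8 * a * b)) ^ 2 ≤ 1 := pow_le_one₀ (by positivity) this
    rwa [mul_pow, Real.sq_sqrt (by positivity)] at h2
  have hent := expEntropy_pi_smul_le μ hf (V := fun x => b * (2 * q x + m)) (by fun_prop) hfV hl.le
  set F := ∫ x, Real.exp (l * f x) ∂π with hF
  have hFp : 0 < F := integral_exp_pos_of_continuous π (h := fun x => l * f x) (by fun_prop)
  -- Decoupling of q from e^{lf}: the test function q/(2a) has its log-moment bounded by E q / a
  -- through self-boundedness.
  have hgib := integral_exp_mul_le_expEntropy_add π (h := fun x => l * f x)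
    (g := fun x => 1 / (2 * a) * q x) (by fun_prop) (by fun_prop)
  change _ ≤ _ + F * cgf q π (1 / (2 * a)) at hgib
  set T := expEntropy π (fun x => l * f x)
  set Q := ∫ x, Real.exp (l * f x) * q x ∂π with hQ
  have e1 : ∫ x, Real.exp (l * f x) * (1 / (2 * a) * q x) ∂π = 1 / (2 * a) * Q := by
    rw [hQ, ← integral_const_mul]; congr 1; ext x; ring
  have e2 : ∫ x, b * (2 * q x + m) * Real.exp (l * f x) ∂π = b * (2 * Q + m * F) := by
    have : ∀ x, b * (2 * q x + m) * Real.exp (l * f x)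
      = 2 * b * (Real.exp (l * f x) * q x) + b * m * Real.exp (l * f x) := fun x => by ring
    simp only [this]
    rw [integral_add (integrable_of_continuous_compact (by fun_prop))
      (integrable_of_continuous_compact (by fun_prop)), integral_const_mul, integral_const_mul]
    ring
  rw [e1] at hgib
  rw [e2] at hent
  have hQle : Q ≤ 2 * a * T + 2 * F * m := by
    have h1 : 1 / (2 * a) * Q ≤ T + F * (m / a) :=
      hgib.trans (by gcongr)
    have h2 := mul_le_mul_of_nonneg_left h1 (show 0 ≤ 2 * a by positivity)
    have e3 : 2 * a * (1 / (2 * a) * Q) = Q := by field_simp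
    have e4 : 2 * a * (T + F * (m / a)) = 2 * a * T + 2 * F * m := by field_simp
    linarith
  have hl2p : 0 ≤ l ^ 2 * b := by positivity
  have h5 : T ≤ l ^ 2 * b * (4 * a * T + 5 * F * m) := by
    refine hent.trans ?_
    rw [← mul_assoc]
    apply mul_le_mul_of_nonneg_left _ hl2p
    nlinarith
  rw [zero_mul, add_zero]
  have hFm : F * m ≤ F * w := by gcongr
  rcases le_total T 0 with hT | hT
  · exact hT.trans (by positivity)
  · have h6 : l ^ 2 * b * (4 * a * T) ≤ T / 2 := by nlinarith
    nlinarith [mul_le_mul_of_nonneg_left hFm hl2p]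

end Product

/-! ### Quadratic forms, norms and their one-coordinate increments. -/

section QuadraticForms

variable {n : ℕ}

theorem normMulVec_sq (A : Matrix (Fin n) (Fin n) ℝ) (x : Fin n → ℝ) :
    normMulVec A x ^ 2 = ∑ i, (A *ᵥ x) i ^ 2 := by
  simp [normMulVec, EuclideanSpace.norm_sq_eq]

theorem normMulVec_nonneg (A : Matrix (Fin n) (Fin n) ℝ) (x : Fin n → ℝ) : 0 ≤ normMulVec A x :=
  norm_nonneg _

theorem normMulVec_mulVec_le (A B : Matrix (Fin n) (Fin n) ℝ) (x : Fin n → ℝ) :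
    normMulVec A (B *ᵥ x) ≤ ‖Matrix.toEuclideanCLM (n := Fin n) (𝕜 := ℝ) A‖ * normMulVec B x := by
  have := (Matrix.toEuclideanCLM (n := Fin n) (𝕜 := ℝ) A).le_opNorm (WithLp.toLp 2 (B *ᵥ x))
  rwa [Matrix.toEuclideanCLM_toLp] at this

theorem continuous_normMulVec (A : Matrix (Fin n) (Fin n) ℝ) : Continuous (normMulVec A) := by
  unfold normMulVec
  exact ((PiLp.continuous_toLp 2 _).comp (by fun_prop)).norm

theorem continuous_supNormMulVec (𝒜 : Finset (Matrix (Fin n) (Fin n) ℝ)) (h𝒜 : 𝒜.Nonempty) :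
    Continuous (supNormMulVec 𝒜 h𝒜) :=
  Continuous.finset_sup'_apply h𝒜 fun A _ => continuous_normMulVec A

theorem continuous_supNormDiagMulVec (𝒜 : Finset (Matrix (Fin n) (Fin n) ℝ)) (h𝒜 : 𝒜.Nonempty) :
    Continuous (supNormDiagMulVec 𝒜 h𝒜) :=
  Continuous.finset_sup'_apply h𝒜 fun A _ => continuous_normMulVec (diagPart A)

theorem continuous_supQuadForm (𝒜 : Finset (Matrix (Fin n) (Fin n) ℝ)) (h𝒜 : 𝒜.Nonempty)
    (g : Matrix (Fin n) (Fin n) ℝ → ℝ) : Continuous (supQuadForm 𝒜 h𝒜 g) :=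
  Continuous.finset_sup'_apply h𝒜 fun A _ => by fun_prop

theorem supNormMulVec_nonneg (𝒜 : Finset (Matrix (Fin n) (Fin n) ℝ)) (h𝒜 : 𝒜.Nonempty)
    (x : Fin n → ℝ) : 0 ≤ supNormMulVec 𝒜 h𝒜 x := by
  obtain ⟨A, hA⟩ := h𝒜
  exact (normMulVec_nonneg A x).trans (Finset.le_sup' (fun A => normMulVec A x) hA)

theorem supNormDiagMulVec_nonneg (𝒜 : Finset (Matrix (Fin n) (Fin n) ℝ)) (h𝒜 : 𝒜.Nonempty)
    (x : Fin n → ℝ) : 0 ≤ supNormDiagMulVec 𝒜 h𝒜 x := by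
  obtain ⟨A, hA⟩ := h𝒜
  exact (normMulVec_nonneg _ x).trans (Finset.le_sup' (fun A => normMulVec (diagPart A) x) hA)

theorem abs_diag_le_norm (A : Matrix (Fin n) (Fin n) ℝ) (i : Fin n) :
    |A i i| ≤ ‖Matrix.toEuclideanCLM (n := Fin n) (𝕜 := ℝ) A‖ := by
  have h := (Matrix.toEuclideanCLM (n := Fin n) (𝕜 := ℝ) A).le_opNorm
    (EuclideanSpace.single i 1)
  rw [PiLp.norm_single, norm_one, mul_one] at h
  refine le_trans ?_ h
  have h2 := PiLp.norm_apply_le (Matrix.toEuclideanCLM (n := Fin n) (𝕜 := ℝ) A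
    (EuclideanSpace.single i 1)) i
  rw [Matrix.ofLp_toEuclideanCLM] at h2
  simpa using h2

/-- Each |A_ii| is at most ‖A‖, so adjoining diagonal parts to the family does not raise the
operator norm bound. -/
theorem norm_diagPart_le (A : Matrix (Fin n) (Fin n) ℝ) :
    ‖Matrix.toEuclideanCLM (n := Fin n) (𝕜 := ℝ) (diagPart A)‖
      ≤ ‖Matrix.toEuclideanCLM (n := Fin n) (𝕜 := ℝ) A‖ := by
  refine ContinuousLinearMap.opNorm_le_bound _ (norm_nonneg _) fun x => ?_
  refine abs_le_of_sq_le_sq' ?_ (by positivity) |>.2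
  rw [mul_pow, EuclideanSpace.norm_sq_eq, EuclideanSpace.norm_sq_eq, Finset.mul_sum]
  refine Finset.sum_le_sum fun i _ => ?_
  rw [Matrix.ofLp_toEuclideanCLM, diagPart, Matrix.mulVec_diagonal, norm_mul, mul_pow]
  gcongr
  exact abs_diag_le_norm A i

theorem mulVec_update (A : Matrix (Fin n) (Fin n) ℝ) (x : Fin n → ℝ) (i : Fin n) (s : ℝ) :
    A *ᵥ (Function.update x i s) = A *ᵥ x - (x i - s) • A.col i := by
  have : Function.update x i s = x - (x i - s) • Pi.single i (1 : ℝ) := by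
    ext j
    by_cases h : j = i
    · subst h; simp
    · simp [h]
  rw [this, Matrix.mulVec_sub, Matrix.mulVec_smul, Matrix.mulVec_single_one]

/-- The increment of a quadratic form under a change of one coordinate. -/
theorem quadForm_sub_update {A : Matrix (Fin n) (Fin n) ℝ} (hA : A.IsSymm) (x : Fin n → ℝ)
    (i : Fin n) (s : ℝ) :
    x ⬝ᵥ A *ᵥ x - Function.update x i s ⬝ᵥ A *ᵥ Function.update x i s
      = 2 * (x i - s) * (A *ᵥ x) i - (x i - s) ^ 2 * A i i := by
  have hu : Function.update x i s = x - (x i - s) • Pi.single i (1 : ℝ) := by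
    ext j
    by_cases h : j = i
    · subst h; simp
    · simp [h]
  have hc : x ⬝ᵥ A.col i = (A *ᵥ x) i := by
    rw [dotProduct_comm, Matrix.mulVec]
    congr 1
    ext j
    exact hA.apply _ _
  rw [mulVec_update, hu, sub_dotProduct, dotProduct_sub, dotProduct_sub, dotProduct_smul,
    dotProduct_smul, smul_dotProduct, smul_dotProduct, hc, single_one_dotProduct,
    single_one_dotProduct]
  simp only [smul_eq_mul, Matrix.col_apply]
  ring

/-- The increment of `‖A x‖²` under a change of one coordinate. -/
theorem normMulVec_sq_sub_update {A : Matrix (Fin n) (Fin n) ℝ} (hA : A.IsSymm) (x : Fin n → ℝ)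
    (i : Fin n) (s : ℝ) :
    normMulVec A x ^ 2 - normMulVec A (Function.update x i s) ^ 2
      ≤ 2 * (x i - s) * (A *ᵥ (A *ᵥ x)) i := by
  -- ‖Ay‖² is the quadratic form of A², whose diagonal is nonnegative; the second-order term of the
  -- increment thus has a favourable sign.
  have e : ∀ y, normMulVec A y ^ 2 = y ⬝ᵥ (A * A) *ᵥ y := by
    intro y
    rw [normMulVec_sq, ← Matrix.mulVec_mulVec, Matrix.dotProduct_mulVec, ← Matrix.mulVec_transpose,
      hA.eq]
    simp [dotProduct, sq]
  have hAA : (A * A).IsSymm := by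
    rw [Matrix.IsSymm, Matrix.transpose_mul, hA.eq]
  rw [e, e, quadForm_sub_update hAA, Matrix.mulVec_mulVec]
  have : 0 ≤ (A * A) i i := by
    rw [Matrix.mul_apply]
    refine Finset.sum_nonneg fun j _ => ?_
    rw [hA.apply i j]
    exact mul_self_nonneg _
  nlinarith [mul_nonneg (sq_nonneg (x i - s)) this]

end QuadraticForms

/-! ### Concentration on the box [-K, K]^n. -/

section Box

variable {n : ℕ} {K : ℝ}

/-- The vector of reals underlying a point of the box `[-K, K]^n`. -/
def boxCoe (x : Fin n → Set.Icc (-K) K) : Fin n → ℝ := fun i => x i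

theorem continuous_boxCoe : Continuous (boxCoe : (Fin n → Set.Icc (-K) K) → _) := by
  unfold boxCoe; fun_prop

theorem boxCoe_update (x : Fin n → Set.Icc (-K) K) (i : Fin n) (s : Set.Icc (-K) K) :
    boxCoe (Function.update x i s) = Function.update (boxCoe x) i (s : ℝ) := by
  ext j
  by_cases h : j = i
  · subst h; simp [boxCoe]
  · simp [boxCoe, h]

theorem abs_boxCoe_sub_le (x : Fin n → Set.Icc (-K) K) (i : Fin n) (s : Set.Icc (-K) K) :
    (boxCoe x i - s) ^ 2 ≤ 4 * K ^ 2 := by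
  have h1 := (x i).2
  have h2 := s.2
  simp only [Set.mem_Icc] at h1 h2
  change ((x i : ℝ) - s) ^ 2 ≤ _
  nlinarith

theorem sum_integral_le_of_forall_le {μ : Fin n → Measure (Set.Icc (-K) K)}
    [∀ i, IsProbabilityMeasure (μ i)] {F : Fin n → Set.Icc (-K) K → ℝ}
    (hF : ∀ i, Continuous (F i)) {c : Fin n → ℝ} (h : ∀ i s, F i s ≤ c i) :
    ∑ i, ∫ s, F i s ∂(μ i) ≤ ∑ i, c i := by
  refine Finset.sum_le_sum fun i _ => ?_
  calc _ ≤ ∫ _, c i ∂(μ i) := integral_mono (integrable_of_continuous_compact (hF i))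
        (integrable_const _) (h i)
    _ = c i := by simp

variable (μ : Fin n → Measure (Set.Icc (-K) K)) [∀ i, IsProbabilityMeasure (μ i)]
  (𝒜 : Finset (Matrix (Fin n) (Fin n) ℝ)) (h𝒜 : 𝒜.Nonempty)

/-- A maximizer A at x is a competitor at the modified point, so the positive increment is at most
that of ‖A·‖², namely 2(x_i - s)(A²x)_i. Since ‖A²x‖ ≤ L‖Ax‖, summing the squares gives the bound,
with 16K² = 2²(2K)². The same `c` serves for both the supremum and its square. -/
theorem supNormMulVec_sq_sub_update_le (hsymm : ∀ A ∈ 𝒜, A.IsSymm) {L : ℝ}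
    (hL : ∀ A ∈ 𝒜, ‖Matrix.toEuclideanCLM (n := Fin n) (𝕜 := ℝ) A‖ ≤ L)
    (x : Fin n → Set.Icc (-K) K) :
    ∃ c : Fin n → ℝ, ∑ i, c i ≤ 16 * K ^ 2 * L ^ 2 * supNormMulVec 𝒜 h𝒜 (boxCoe x) ^ 2 ∧
      ∀ i s, (max (supNormMulVec 𝒜 h𝒜 (boxCoe x) ^ 2
        - supNormMulVec 𝒜 h𝒜 (boxCoe (Function.update x i s)) ^ 2) 0) ^ 2 ≤ c i := by
  obtain ⟨A, hA, hAx⟩ := Finset.exists_mem_eq_sup' h𝒜 (fun A => normMulVec A (boxCoe x))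
  change supNormMulVec 𝒜 h𝒜 (boxCoe x) = _ at hAx
  refine ⟨fun i => 16 * K ^ 2 * (A *ᵥ (A *ᵥ boxCoe x)) i ^ 2, ?_, fun i s => ?_⟩
  · rw [← Finset.mul_sum, ← normMulVec_sq, hAx]
    have h1 := normMulVec_mulVec_le A A (boxCoe x)
    have h2 := hL A hA
    have h0 := normMulVec_nonneg A (A *ᵥ boxCoe x)
    have h00 := normMulVec_nonneg A (boxCoe x)
    have h3 := pow_le_pow_left₀ h0 (h1.trans (mul_le_mul_of_nonneg_right h2 h00)) 2
    have h4 := mul_le_mul_of_nonneg_left h3 (show 0 ≤ 16 * K ^ 2 by positivity)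
    linarith
  · rw [hAx, boxCoe_update]
    have h1 := normMulVec_sq_sub_update (hsymm A hA) (boxCoe x) i s
    have h2 : normMulVec A (Function.update (boxCoe x) i s)
        ≤ supNormMulVec 𝒜 h𝒜 (Function.update (boxCoe x) i s) :=
      Finset.le_sup' (fun A => normMulVec A _) hA
    have h3 := pow_le_pow_left₀ (normMulVec_nonneg A _) h2 2
    have h4 := abs_boxCoe_sub_le x i s
    set d := boxCoe x i - (s : ℝ)
    set w := (A *ᵥ (A *ᵥ boxCoe x)) i
    have h5 : (max (normMulVec A (boxCoe x) ^ 2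
        - supNormMulVec 𝒜 h𝒜 (Function.update (boxCoe x) i s) ^ 2) 0) ≤ |2 * d * w| := by
      refine max_le (le_trans ?_ (le_abs_self _)) (abs_nonneg _)
      linarith
    calc _ ≤ |2 * d * w| ^ 2 := by gcongr
      _ = 4 * d ^ 2 * w ^ 2 := by rw [sq_abs]; ring
      _ ≤ 4 * (4 * K ^ 2) * w ^ 2 := by gcongr
      _ = _ := by ring

theorem sum_integral_supNormMulVec_sq_le (hsymm : ∀ A ∈ 𝒜, A.IsSymm) {L : ℝ}
    (hL : ∀ A ∈ 𝒜, ‖Matrix.toEuclideanCLM (n := Fin n) (𝕜 := ℝ) A‖ ≤ L)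
    (x : Fin n → Set.Icc (-K) K) :
    ∑ i, ∫ s, (max (supNormMulVec 𝒜 h𝒜 (boxCoe x) ^ 2
        - supNormMulVec 𝒜 h𝒜 (boxCoe (Function.update x i s)) ^ 2) 0) ^ 2 ∂(μ i)
      ≤ 16 * K ^ 2 * L ^ 2 * supNormMulVec 𝒜 h𝒜 (boxCoe x) ^ 2 := by
  obtain ⟨c, hc, h⟩ := supNormMulVec_sq_sub_update_le 𝒜 h𝒜 hsymm hL x
  have := continuous_supNormMulVec 𝒜 h𝒜
  have := continuous_boxCoe (n := n) (K := K)
  exact (sum_integral_le_of_forall_le (fun i => by fun_prop) h).trans hc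

theorem sum_integral_supNormMulVec_le (hsymm : ∀ A ∈ 𝒜, A.IsSymm) {L : ℝ}
    (hL : ∀ A ∈ 𝒜, ‖Matrix.toEuclideanCLM (n := Fin n) (𝕜 := ℝ) A‖ ≤ L)
    (x : Fin n → Set.Icc (-K) K) :
    ∑ i, ∫ s, (max (supNormMulVec 𝒜 h𝒜 (boxCoe x)
        - supNormMulVec 𝒜 h𝒜 (boxCoe (Function.update x i s))) 0) ^ 2 ∂(μ i)
      ≤ 16 * K ^ 2 * L ^ 2 := by
  obtain ⟨c, hc, h⟩ := supNormMulVec_sq_sub_update_le 𝒜 h𝒜 hsymm hL x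
  have := continuous_supNormMulVec 𝒜 h𝒜
  have := continuous_boxCoe (n := n) (K := K)
  have hn := supNormMulVec_nonneg 𝒜 h𝒜
  rcases (hn (boxCoe x)).eq_or_lt with h0 | h0
  · refine (sum_integral_le_of_forall_le (c := fun _ => 0) (fun i => by fun_prop)
      fun i s => ?_).trans (by simp; positivity)
    rw [← h0, max_eq_right (by linarith [hn (boxCoe (Function.update x i s))])]
    simp
  -- For 0 ≤ r' ≤ r one has (r - r')r ≤ r² - r'², so dividing by r² cancels the supremum in the
  -- bound for the square.
  · set r := supNormMulVec 𝒜 h𝒜 (boxCoe x)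
    refine (sum_integral_le_of_forall_le (c := fun i => c i / r ^ 2) (fun i => by fun_prop)
      fun i s => ?_).trans ?_
    · rw [le_div_iff₀ (by positivity), ← mul_pow]
      refine le_trans ?_ (h i s)
      have h1 := hn (boxCoe (Function.update x i s))
      gcongr
      rw [max_mul_of_nonneg _ _ h0.le, zero_mul]
      refine max_le ?_ (le_max_right _ _)
      rcases le_total r (supNormMulVec 𝒜 h𝒜 (boxCoe (Function.update x i s))) with h2 | h2
      · exact le_max_of_le_right (by nlinarith)
      · exact le_max_of_le_left (by nlinarith)
    · rw [← Finset.sum_div, div_le_iff₀ (by positivity)]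
      exact hc

/-- `𝒜` together with the diagonal parts of its members. -/
noncomputable def withDiag : Finset (Matrix (Fin n) (Fin n) ℝ) := by
  classical exact 𝒜 ∪ 𝒜.image diagPart

theorem mem_withDiag {A : Matrix (Fin n) (Fin n) ℝ} :
    A ∈ withDiag 𝒜 ↔ A ∈ 𝒜 ∨ ∃ B ∈ 𝒜, diagPart B = A := by
  simp [withDiag]

theorem withDiag_nonempty (𝒜 : Finset (Matrix (Fin n) (Fin n) ℝ)) (h𝒜 : 𝒜.Nonempty) :
    (withDiag 𝒜).Nonempty := by
  obtain ⟨A, hA⟩ := h𝒜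
  exact ⟨A, (mem_withDiag 𝒜).2 (Or.inl hA)⟩

theorem supNormMulVec_withDiag_le (x : Fin n → ℝ) :
    supNormMulVec (withDiag 𝒜) (withDiag_nonempty 𝒜 h𝒜) x
      ≤ supNormMulVec 𝒜 h𝒜 x + supNormDiagMulVec 𝒜 h𝒜 x := by
  refine Finset.sup'_le _ _ fun A hA => ?_
  rcases (mem_withDiag 𝒜).1 hA with h | ⟨B, h, rfl⟩
  · exact le_add_of_le_of_nonneg (Finset.le_sup' (fun A => normMulVec A x) h)
      (supNormDiagMulVec_nonneg 𝒜 h𝒜 x)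
  · exact le_add_of_nonneg_of_le (supNormMulVec_nonneg 𝒜 h𝒜 x)
      (Finset.le_sup' (fun A => normMulVec (diagPart A) x) h)

/-- Again a maximizer at x is kept. Its increment is 2dw - d²A_ii with d = x_i - s and w = (Ax)_i.
One factor d² is bounded by 4K², while in (A_ii d)² the difference is expanded, so that the diagonal
contributes norms of Diag(A)x and Diag(A)X instead of a dimension-dependent K²∑A_ii². -/
theorem sum_integral_supQuadForm_le (g : Matrix (Fin n) (Fin n) ℝ → ℝ)
    (hsymm : ∀ A ∈ 𝒜, A.IsSymm) (x : Fin n → Set.Icc (-K) K) :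
    ∑ i, ∫ s, (max (supQuadForm 𝒜 h𝒜 g (boxCoe x)
        - supQuadForm 𝒜 h𝒜 g (boxCoe (Function.update x i s))) 0) ^ 2 ∂(μ i)
      ≤ 32 * K ^ 2 *
        (2 * supNormMulVec (withDiag 𝒜) (withDiag_nonempty 𝒜 h𝒜) (boxCoe x) ^ 2
        + ∫ y, supNormMulVec (withDiag 𝒜) (withDiag_nonempty 𝒜 h𝒜) (boxCoe y) ^ 2
          ∂(Measure.pi μ)) := by
  have c1 := continuous_supQuadForm 𝒜 h𝒜 g
  have c2 := continuous_boxCoe (n := n) (K := K)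
  have c3 := continuous_supNormMulVec (withDiag 𝒜) (withDiag_nonempty 𝒜 h𝒜)
  have hR : ∀ B ∈ withDiag 𝒜, ∀ y, normMulVec B y ^ 2
      ≤ supNormMulVec (withDiag 𝒜) (withDiag_nonempty 𝒜 h𝒜) y ^ 2 := fun B hB y =>
    pow_le_pow_left₀ (normMulVec_nonneg B y) (Finset.le_sup' (fun A => normMulVec A y) hB) 2
  obtain ⟨A, hA, hAx⟩ := Finset.exists_mem_eq_sup' h𝒜
    (fun A => boxCoe x ⬝ᵥ A *ᵥ boxCoe x - g A)
  change supQuadForm 𝒜 h𝒜 g (boxCoe x) = _ at hAx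
  have hpt : ∀ i s, (max (supQuadForm 𝒜 h𝒜 g (boxCoe x)
        - supQuadForm 𝒜 h𝒜 g (boxCoe (Function.update x i s))) 0) ^ 2
      ≤ 32 * K ^ 2 * (A *ᵥ boxCoe x) i ^ 2 + 16 * K ^ 2 * (A i i * boxCoe x i) ^ 2
        + 16 * K ^ 2 * (A i i * s) ^ 2 := by
    intro i s
    rw [hAx, boxCoe_update]
    have h1 := quadForm_sub_update (hsymm A hA) (boxCoe x) i s
    have h2 : _ ≤ supQuadForm 𝒜 h𝒜 g (Function.update (boxCoe x) i s) :=
      Finset.le_sup' (fun A => Function.update (boxCoe x) i (s : ℝ) ⬝ᵥ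
        A *ᵥ Function.update (boxCoe x) i (s : ℝ) - g A) hA
    have h4 := abs_boxCoe_sub_le x i s
    set d := boxCoe x i - (s : ℝ) with hd
    set w := (A *ᵥ boxCoe x) i
    have h5 : (max (boxCoe x ⬝ᵥ A *ᵥ boxCoe x - g A
        - supQuadForm 𝒜 h𝒜 g (Function.update (boxCoe x) i s)) 0)
        ≤ |2 * d * w - d ^ 2 * A i i| := by
      refine max_le (le_trans ?_ (le_abs_self _)) (abs_nonneg _)
      linarith
    calc _ ≤ |2 * d * w - d ^ 2 * A i i| ^ 2 := by gcongr
      _ ≤ d ^ 2 * (8 * w ^ 2 + 2 * (A i i * d) ^ 2) := by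
        rw [sq_abs]
        nlinarith [mul_nonneg (sq_nonneg d) (sq_nonneg (2 * w + d * A i i))]
      _ ≤ d ^ 2 * (8 * w ^ 2 + 4 * (A i i * boxCoe x i) ^ 2 + 4 * (A i i * s) ^ 2) := by
        refine mul_le_mul_of_nonneg_left ?_ (sq_nonneg d)
        rw [hd]
        nlinarith [sq_nonneg (A i i * boxCoe x i + A i i * s)]
      _ ≤ 4 * K ^ 2 * (8 * w ^ 2 + 4 * (A i i * boxCoe x i) ^ 2 + 4 * (A i i * s) ^ 2) := by
        gcongr
      _ = _ := by ring
  have hD : ∀ y : Fin n → ℝ, ∑ i, (A i i * y i) ^ 2 = normMulVec (diagPart A) y ^ 2 := by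
    intro y
    simp [normMulVec_sq, diagPart, Matrix.mulVec_diagonal]
  have hint : ∀ i, ∫ s, (max (supQuadForm 𝒜 h𝒜 g (boxCoe x)
        - supQuadForm 𝒜 h𝒜 g (boxCoe (Function.update x i s))) 0) ^ 2 ∂(μ i)
      ≤ 32 * K ^ 2 * (A *ᵥ boxCoe x) i ^ 2 + 16 * K ^ 2 * (A i i * boxCoe x i) ^ 2
        + 16 * K ^ 2 * ∫ s : Set.Icc (-K) K, (A i i * (s : ℝ)) ^ 2 ∂(μ i) := by
    intro i
    refine (integral_mono (integrable_of_continuous_compact (by fun_prop))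
      (integrable_of_continuous_compact (by fun_prop)) (hpt i)).trans (le_of_eq ?_)
    rw [integral_add (integrable_const _) (integrable_of_continuous_compact (by fun_prop)),
      integral_const_mul]
    simp
  -- The resampled coordinates have the marginal laws, so their contributions add up to the second
  -- moment of ‖Diag(A)X‖.
  have hcoord : ∑ i, ∫ s : Set.Icc (-K) K, (A i i * (s : ℝ)) ^ 2 ∂(μ i)
      = ∫ y, normMulVec (diagPart A) (boxCoe y) ^ 2 ∂(Measure.pi μ) := by
    simp only [← hD]
    rw [integral_finsetSum _ fun i _ => integrable_of_continuous_compact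
      (by unfold boxCoe; fun_prop)]
    refine Finset.sum_congr rfl fun i _ => ?_
    exact (integral_comp_eval (μ := μ) (i := i) (f := fun s : Set.Icc (-K) K =>
      (A i i * (s : ℝ)) ^ 2) (by fun_prop)).symm
  refine (Finset.sum_le_sum fun i _ => hint i).trans ?_
  rw [Finset.sum_add_distrib, Finset.sum_add_distrib, ← Finset.mul_sum, ← Finset.mul_sum,
    ← Finset.mul_sum, ← normMulVec_sq, hD, hcoord]
  have h1 := hR A ((mem_withDiag 𝒜).2 (Or.inl hA)) (boxCoe x)
  have hDm := (mem_withDiag 𝒜).2 (Or.inr ⟨A, hA, rfl⟩)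
  have h2 := hR _ hDm (boxCoe x)
  have h3 : ∫ y, normMulVec (diagPart A) (boxCoe y) ^ 2 ∂(Measure.pi μ)
      ≤ ∫ y, supNormMulVec (withDiag 𝒜) (withDiag_nonempty 𝒜 h𝒜) (boxCoe y) ^ 2
        ∂(Measure.pi μ) := by
    have := continuous_normMulVec (diagPart A)
    exact integral_mono (integrable_of_continuous_compact (by fun_prop))
      (integrable_of_continuous_compact (by fun_prop)) fun y => hR _ hDm _
  have hI0 : 0 ≤ ∫ y, normMulVec (diagPart A) (boxCoe y) ^ 2 ∂(Measure.pi μ) :=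
    integral_nonneg fun y => sq_nonneg _
  have hK : 0 ≤ K ^ 2 := sq_nonneg K
  have := mul_le_mul_of_nonneg_left h1 hK
  have := mul_le_mul_of_nonneg_left h2 hK
  have := mul_le_mul_of_nonneg_left h3 hK
  have := mul_nonneg hK (sq_nonneg (normMulVec (diagPart A) (boxCoe x)))
  have := mul_nonneg hK hI0
  nlinarith

/-- Concentration on the box, with the expected norms of `A X` and `Diag(A) X`. -/
theorem measureReal_supQuadForm_box (hK : 0 < K) (g : Matrix (Fin n) (Fin n) ℝ → ℝ)
    (hsymm : ∀ A ∈ 𝒜, A.IsSymm) {L : ℝ} (hL0 : 0 < L)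
    (hL : ∀ A ∈ 𝒜, ‖Matrix.toEuclideanCLM (n := Fin n) (𝕜 := ℝ) A‖ ≤ L) {t : ℝ} (ht : 1 ≤ t) :
    1 - Real.exp (-t) ≤ (Measure.pi μ).real {x | supQuadForm 𝒜 h𝒜 g (boxCoe x)
      - ∫ y, supQuadForm 𝒜 h𝒜 g (boxCoe y) ∂(Measure.pi μ) ≤
        800 * (K * (∫ y, supNormMulVec 𝒜 h𝒜 (boxCoe y) ∂(Measure.pi μ)
          + ∫ y, supNormDiagMulVec 𝒜 h𝒜 (boxCoe y) ∂(Measure.pi μ)) * Real.sqrt t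
          + K ^ 2 * L * t)} := by
  have c1 := continuous_supQuadForm 𝒜 h𝒜 g
  have c2 := continuous_boxCoe (n := n) (K := K)
  have c3 := continuous_supNormMulVec (withDiag 𝒜) (withDiag_nonempty 𝒜 h𝒜)
  have c4 := continuous_supNormMulVec 𝒜 h𝒜
  have c5 := continuous_supNormDiagMulVec 𝒜 h𝒜
  have hsymm' : ∀ A ∈ withDiag 𝒜, A.IsSymm := by
    intro A hA
    rcases (mem_withDiag 𝒜).1 hA with h | ⟨B, h, rfl⟩
    · exact hsymm A h
    · exact Matrix.isSymm_diagonal _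
  have hL' : ∀ A ∈ withDiag 𝒜, ‖Matrix.toEuclideanCLM (n := Fin n) (𝕜 := ℝ) A‖ ≤ L := by
    intro A hA
    rcases (mem_withDiag 𝒜).1 hA with h | ⟨B, h, rfl⟩
    · exact hL A h
    · exact (norm_diagPart_le B).trans (hL B h)
  set R : (Fin n → Set.Icc (-K) K) → ℝ := fun x =>
    supNormMulVec (withDiag 𝒜) (withDiag_nonempty 𝒜 h𝒜) (boxCoe x) with hR
  have cR : Continuous R := by fun_prop
  set a := 16 * K ^ 2 * L ^ 2 with ha
  have ha0 : 0 < a := by positivity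
  set m := ∫ x, R x ∂(Measure.pi μ)
  have hm0 : 0 ≤ m := integral_nonneg fun x => supNormMulVec_nonneg _ _ _
  have hsq := integral_sq_le_of_bounded_differences μ cR
    (fun x => supNormMulVec_nonneg _ _ _) ha0
    (sum_integral_supNormMulVec_le μ _ (withDiag_nonempty 𝒜 h𝒜) hsymm' hL')
  have main := measureReal_sub_integral_le_of_self_bounding μ
    (f := fun x => supQuadForm 𝒜 h𝒜 g (boxCoe x)) (q := fun x => R x ^ 2) (by fun_prop)
    (by fun_prop) (fun x => sq_nonneg _) (a := a) (b := 32 * K ^ 2) (w := 2 * m ^ 2 + 12 * a)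
    (t := t) ha0 (by positivity) (by linarith) (by positivity)
    (sum_integral_supNormMulVec_sq_le μ _ (withDiag_nonempty 𝒜 h𝒜) hsymm' hL') hsq
    (sum_integral_supQuadForm_le μ 𝒜 h𝒜 g hsymm)
  refine main.trans (measureReal_mono fun x hx => ?_)
  simp only [Set.mem_ofPred_eq] at hx ⊢
  refine hx.trans ?_
  have hm : m ≤ ∫ y, supNormMulVec 𝒜 h𝒜 (boxCoe y) ∂(Measure.pi μ)
      + ∫ y, supNormDiagMulVec 𝒜 h𝒜 (boxCoe y) ∂(Measure.pi μ) := by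
    rw [← integral_add (integrable_of_continuous_compact (by fun_prop))
      (integrable_of_continuous_compact (by fun_prop))]
    exact integral_mono (integrable_of_continuous_compact cR)
      (integrable_of_continuous_compact (by fun_prop))
      fun y => supNormMulVec_withDiag_le 𝒜 h𝒜 (boxCoe y)
  have hst : 1 ≤ Real.sqrt t := Real.one_le_sqrt.2 ht
  have hst2 : Real.sqrt t ^ 2 = t := Real.sq_sqrt (by linarith)
  set r := Real.sqrt t
  have e1 : Real.sqrt (8 * a * (32 * K ^ 2)) = 64 * K ^ 2 * L := by
    rw [show 8 * a * (32 * K ^ 2) = (64 * K ^ 2 * L) ^ 2 by rw [ha]; ring,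
      Real.sqrt_sq (by positivity)]
  -- The radicand is 640K²m²t + 61440K⁴L²t, with 640 ≤ 26² and 61440 ≤ 248²; t ≥ 1 is used as t ≤
  -- t². The total is then 52 for the √t term and 2·248 + 2·64 = 624 for the t term, both below 800.
  have e2 : Real.sqrt (10 * (32 * K ^ 2) * (2 * m ^ 2 + 12 * a) * t)
      ≤ 26 * K * m * r + 248 * K ^ 2 * L * t := by
    apply Real.sqrt_le_iff.2 ⟨by positivity, ?_⟩
    rw [ha, ← hst2]
    have h1 : r ^ 2 ≤ r ^ 4 := pow_le_pow_right₀ hst (by norm_num)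
    have h2 : 0 ≤ K ^ 4 * L ^ 2 := by positivity
    have h3 := mul_le_mul_of_nonneg_left h1 h2
    have h4 : 0 ≤ K * m * r * (K ^ 2 * L * r ^ 2) := by positivity
    have h5 : 0 ≤ K ^ 2 * m ^ 2 * r ^ 2 := by positivity
    have h6 : 0 ≤ K ^ 4 * L ^ 2 * r ^ 4 := by positivity
    nlinarith
  rw [e1]
  have h1 : K * m * r ≤ K * (∫ y, supNormMulVec 𝒜 h𝒜 (boxCoe y) ∂(Measure.pi μ)
      + ∫ y, supNormDiagMulVec 𝒜 h𝒜 (boxCoe y) ∂(Measure.pi μ)) * r := by gcongr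
  have h2 : 0 ≤ K * m * r := by positivity
  have h3 : 0 ≤ K ^ 2 * L * t := by positivity
  nlinarith

end Box

/-! ### Diagonal parts as averages over random signs. -/

section Signs

variable {n : ℕ}

/-- The vector `x` with its coordinates multiplied by the signs `s`. -/
def signMul (s : Fin n → ℤˣ) (x : Fin n → ℝ) : Fin n → ℝ := fun i => ((s i : ℤ) : ℝ) * x i

/-- Flipping the i-th sign permutes the sign vectors and negates every summand. -/
theorem sum_sign_mul_sign_of_ne {i j : Fin n} (hij : i ≠ j) :
    ∑ s : Fin n → ℤˣ, ((s i : ℤ) : ℝ) * ((s j : ℤ) : ℝ) = 0 := by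
  have h := Equiv.sum_comp (Equiv.mulLeft (Function.update (1 : Fin n → ℤˣ) i (-1)))
    (fun s : Fin n → ℤˣ => ((s i : ℤ) : ℝ) * ((s j : ℤ) : ℝ))
  simp only [Equiv.coe_mulLeft, Pi.mul_apply, Function.update_self,
    Function.update_of_ne hij.symm, Pi.one_apply, one_mul] at h
  simp only [neg_mul, one_mul, Units.val_neg, Int.cast_neg, Finset.sum_neg_distrib] at h
  linarith

theorem intUnit_cast_mul_self (u : ℤˣ) : ((u : ℤ) : ℝ) * ((u : ℤ) : ℝ) = 1 := by
  rcases Int.units_eq_one_or u with h | h <;> simp [h]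

/-- Averaging over random signs retains only the diagonal of a matrix. -/
theorem card_smul_diagPart_mulVec (A : Matrix (Fin n) (Fin n) ℝ) (x : Fin n → ℝ) :
    (Fintype.card (Fin n → ℤˣ) : ℝ) • (diagPart A *ᵥ x)
      = ∑ s : Fin n → ℤˣ, signMul s (A *ᵥ signMul s x) := by
  ext i
  simp only [Pi.smul_apply, smul_eq_mul, Finset.sum_apply, signMul, Matrix.mulVec, dotProduct]
  simp only [Finset.mul_sum]
  rw [Finset.sum_comm (s := (Finset.univ : Finset (Fin n → ℤˣ)))]
  refine Finset.sum_congr rfl fun j _ => ?_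
  have e : ∀ s : Fin n → ℤˣ, ((s i : ℤ) : ℝ) * (A i j * (((s j : ℤ) : ℝ) * x j))
      = ((s i : ℤ) : ℝ) * ((s j : ℤ) : ℝ) * (A i j * x j) := fun s => by ring
  simp only [e, ← Finset.sum_mul]
  by_cases hij : i = j
  · subst hij
    simp [intUnit_cast_mul_self, diagPart]
  · rw [sum_sign_mul_sign_of_ne hij]
    simp [diagPart, Matrix.diagonal_apply_ne _ hij]

theorem norm_toLp_signMul (s : Fin n → ℤˣ) (x : Fin n → ℝ) :
    ‖WithLp.toLp 2 (signMul s x)‖ = ‖WithLp.toLp 2 x‖ := by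
  rw [EuclideanSpace.norm_eq, EuclideanSpace.norm_eq]
  congr 1
  refine Finset.sum_congr rfl fun i _ => ?_
  rcases Int.units_eq_one_or (s i) with h | h <;> simp [signMul, h]

theorem card_mul_normMulVec_diagPart_le (A : Matrix (Fin n) (Fin n) ℝ) (x : Fin n → ℝ) :
    (Fintype.card (Fin n → ℤˣ) : ℝ) * normMulVec (diagPart A) x
      ≤ ∑ s : Fin n → ℤˣ, normMulVec A (signMul s x) := by
  have h : (Fintype.card (Fin n → ℤˣ) : ℝ) * normMulVec (diagPart A) x
      = ‖∑ s : Fin n → ℤˣ, WithLp.toLp 2 (signMul s (A *ᵥ signMul s x))‖ := by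
    rw [← WithLp.toLp_sum, ← card_smul_diagPart_mulVec, WithLp.toLp_smul, norm_smul, normMulVec]
    simp
  rw [h]
  refine (norm_sum_le _ _).trans (le_of_eq ?_)
  simp only [norm_toLp_signMul, normMulVec]

theorem card_mul_supNormDiagMulVec_le (𝒜 : Finset (Matrix (Fin n) (Fin n) ℝ)) (h𝒜 : 𝒜.Nonempty)
    (x : Fin n → ℝ) :
    (Fintype.card (Fin n → ℤˣ) : ℝ) * supNormDiagMulVec 𝒜 h𝒜 x
      ≤ ∑ s : Fin n → ℤˣ, supNormMulVec 𝒜 h𝒜 (signMul s x) := by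
  obtain ⟨A, hA, hAx⟩ := Finset.exists_mem_eq_sup' h𝒜 (fun A => normMulVec (diagPart A) x)
  change supNormDiagMulVec 𝒜 h𝒜 x = _ at hAx
  rw [hAx]
  exact (card_mul_normMulVec_diagPart_le A x).trans
    (Finset.sum_le_sum fun s _ => Finset.le_sup' (fun A => normMulVec A _) hA)

/-- The vector `x` with the coordinates outside `I` set to zero. -/
def restrictCoords (I : Finset (Fin n)) (x : Fin n → ℝ) : Fin n → ℝ :=
  fun i => if i ∈ I then x i else 0

theorem supNormMulVec_signMul_le (𝒜 : Finset (Matrix (Fin n) (Fin n) ℝ)) (h𝒜 : 𝒜.Nonempty)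
    (s : Fin n → ℤˣ) (x : Fin n → ℝ) :
    supNormMulVec 𝒜 h𝒜 (signMul s x)
      ≤ supNormMulVec 𝒜 h𝒜 (restrictCoords {i | s i = 1} x)
        + supNormMulVec 𝒜 h𝒜 (restrictCoords {i | s i ≠ 1} x) := by
  have e : signMul s x = restrictCoords {i | s i = 1} x - restrictCoords {i | s i ≠ 1} x := by
    ext i
    rcases Int.units_eq_one_or (s i) with h | h <;> simp [signMul, restrictCoords, h]
  refine Finset.sup'_le _ _ fun A hA => ?_
  refine le_trans ?_ (add_le_add (Finset.le_sup' (fun A => normMulVec A _) hA)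
    (Finset.le_sup' (fun A => normMulVec A _) hA))
  rw [e, normMulVec, Matrix.mulVec_sub, WithLp.toLp_sub]
  exact norm_sub_le _ _

end Signs

/-! ### Comparison of diagonal parts with full matrices for centered coordinates. -/

section Centered

variable {n : ℕ} {K : ℝ} (μ : Fin n → Measure (Set.Icc (-K) K)) [∀ i, IsProbabilityMeasure (μ i)]

theorem measurePreserving_pi_piecewise {ι α : Type*} [Fintype ι] [DecidableEq ι]
    [MeasurableSpace α] (μ : ι → Measure α) [∀ i, IsProbabilityMeasure (μ i)] (I : Finset ι) :
    MeasurePreserving (fun p : (ι → α) × (ι → α) => fun i => if i ∈ I then p.1 i else p.2 i)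
      ((Measure.pi μ).prod (Measure.pi μ)) (Measure.pi μ) := by
  have hm : Measurable (fun p : (ι → α) × (ι → α) => fun i => if i ∈ I then p.1 i else p.2 i) := by
    refine measurable_pi_lambda _ fun i => ?_
    by_cases h : i ∈ I <;> simp only [h, if_true, if_false] <;> fun_prop
  refine ⟨hm, ?_⟩
  symm
  refine Measure.pi_eq fun s hs => ?_
  rw [Measure.map_apply hm (MeasurableSet.univ_pi hs)]
  have e : (fun p : (ι → α) × (ι → α) => fun i => if i ∈ I then p.1 i else p.2 i) ⁻¹'
        (Set.univ.pi s)
      = (Set.univ.pi fun i => if i ∈ I then s i else Set.univ) ×ˢ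
        (Set.univ.pi fun i => if i ∈ I then Set.univ else s i) := by
    ext p
    simp only [Set.mem_preimage, Set.mem_pi, Set.mem_univ, true_implies, Set.mem_prod]
    rw [← forall_and]
    refine forall_congr' fun i => ?_
    by_cases h : i ∈ I <;> simp [h]
  rw [e, Measure.prod_prod, Measure.pi_pi, Measure.pi_pi, ← Finset.prod_mul_distrib]
  refine Finset.prod_congr rfl fun i _ => ?_
  by_cases h : i ∈ I <;> simp [h]

theorem continuous_restrictCoords (I : Finset (Fin n)) : Continuous (restrictCoords I) := by
  refine continuous_pi fun i => ?_
  unfold restrictCoords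
  by_cases h : i ∈ I <;> simp only [h, if_true, if_false] <;> fun_prop

/-- Averaging AX over the centered coordinates outside I, with those in I fixed, leaves A applied to
the restriction; Jensen's inequality for the supremum of norms concludes. The conditioning is
realized by mixing two independent copies. -/
theorem integral_supNormMulVec_restrictCoords_le (𝒜 : Finset (Matrix (Fin n) (Fin n) ℝ))
    (h𝒜 : 𝒜.Nonempty) (hc : ∀ i, ∫ s : Set.Icc (-K) K, (s : ℝ) ∂(μ i) = 0) (I : Finset (Fin n)) :
    ∫ x, supNormMulVec 𝒜 h𝒜 (restrictCoords I (boxCoe x)) ∂(Measure.pi μ)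
      ≤ ∫ x, supNormMulVec 𝒜 h𝒜 (boxCoe x) ∂(Measure.pi μ) := by
  set mix : (Fin n → Set.Icc (-K) K) × (Fin n → Set.Icc (-K) K) → (Fin n → Set.Icc (-K) K) :=
    fun p i => if i ∈ I then p.1 i else p.2 i with hmix
  have cmix : Continuous mix := by
    refine continuous_pi fun i => ?_
    by_cases h : i ∈ I <;> simp only [hmix, h, if_true, if_false] <;> fun_prop
  have c1 := continuous_boxCoe (n := n) (K := K)
  have c2 := continuous_supNormMulVec 𝒜 h𝒜
  have c3 := continuous_restrictCoords I
  have hmp := measurePreserving_pi_piecewise μ I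
  have e : ∫ x, supNormMulVec 𝒜 h𝒜 (boxCoe x) ∂(Measure.pi μ)
      = ∫ x, ∫ y, supNormMulVec 𝒜 h𝒜 (boxCoe (mix (x, y))) ∂(Measure.pi μ) ∂(Measure.pi μ) := by
    rw [← integral_prod (fun p => supNormMulVec 𝒜 h𝒜 (boxCoe (mix p)))
      (integrable_of_continuous_compact (by fun_prop)), ← hmp.map_eq,
      integral_map hmp.measurable.aemeasurable]
    · rw [hmp.map_eq]
    · exact (by fun_prop : Continuous fun x => supNormMulVec 𝒜 h𝒜
        (boxCoe x)).aestronglyMeasurable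
  rw [e]
  refine integral_mono (integrable_of_continuous_compact (by fun_prop))
    (integrable_of_continuous_compact (continuous_integral_of_continuous
      (F := fun x y => supNormMulVec 𝒜 h𝒜 (boxCoe (mix (x, y)))) _ (by fun_prop))) fun x => ?_
  refine Finset.sup'_le _ _ fun A hA => ?_
  have ccoord : ∀ i, Continuous fun y => (A *ᵥ boxCoe (mix (x, y))) i := fun i => by fun_prop
  have hvec : WithLp.toLp 2 (A *ᵥ restrictCoords I (boxCoe x))
      = ∫ y, WithLp.toLp 2 (A *ᵥ boxCoe (mix (x, y))) ∂(Measure.pi μ) := by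
    ext i
    rw [eval_integral_piLp fun i => integrable_of_continuous_compact (ccoord i)]
    simp only [Matrix.mulVec, dotProduct]
    rw [integral_finsetSum _ fun j _ => integrable_of_continuous_compact
      (by unfold boxCoe; fun_prop)]
    refine Finset.sum_congr rfl fun j _ => ?_
    rw [integral_const_mul]
    congr 1
    by_cases h : j ∈ I
    · simp [restrictCoords, boxCoe, hmix, h]
    · have := integral_comp_eval (μ := μ) (i := j) (f := fun s : Set.Icc (-K) K => (s : ℝ))
        (by fun_prop)
      simp only [restrictCoords, boxCoe, hmix, h, if_false]
      rw [this, hc]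
  have cN := continuous_normMulVec A
  calc normMulVec A (restrictCoords I (boxCoe x))
      = ‖∫ y, WithLp.toLp 2 (A *ᵥ boxCoe (mix (x, y))) ∂(Measure.pi μ)‖ := by
        rw [← hvec, normMulVec]
    _ ≤ ∫ y, normMulVec A (boxCoe (mix (x, y))) ∂(Measure.pi μ) :=
        norm_integral_le_integral_norm _
    _ ≤ _ := integral_mono (integrable_of_continuous_compact (by fun_prop))
        (integrable_of_continuous_compact
          (c2.comp (c1.comp (cmix.comp (Continuous.prodMk_right x)))))
        fun y => Finset.le_sup' (fun A => normMulVec A _) hA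

/-- For centered coordinates, the diagonal parts are dominated by the full matrices. -/
theorem integral_supNormDiagMulVec_le (𝒜 : Finset (Matrix (Fin n) (Fin n) ℝ))
    (h𝒜 : 𝒜.Nonempty) (hc : ∀ i, ∫ s : Set.Icc (-K) K, (s : ℝ) ∂(μ i) = 0) :
    ∫ x, supNormDiagMulVec 𝒜 h𝒜 (boxCoe x) ∂(Measure.pi μ)
      ≤ 2 * ∫ x, supNormMulVec 𝒜 h𝒜 (boxCoe x) ∂(Measure.pi μ) := by
  have c1 := continuous_boxCoe (n := n) (K := K)
  have c2 := continuous_supNormMulVec 𝒜 h𝒜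
  have c3 := fun I => continuous_restrictCoords (n := n) I
  have c4 := continuous_supNormDiagMulVec 𝒜 h𝒜
  have c5 : ∀ s : Fin n → ℤˣ, Continuous (signMul s) := fun s => by unfold signMul; fun_prop
  have hs : ∀ s : Fin n → ℤˣ, ∫ x, supNormMulVec 𝒜 h𝒜 (signMul s (boxCoe x)) ∂(Measure.pi μ)
      ≤ 2 * ∫ x, supNormMulVec 𝒜 h𝒜 (boxCoe x) ∂(Measure.pi μ) := by
    intro s
    refine (integral_mono (integrable_of_continuous_compact (by fun_prop))
      (integrable_of_continuous_compact (by fun_prop))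
      fun x => supNormMulVec_signMul_le 𝒜 h𝒜 s (boxCoe x)).trans ?_
    rw [integral_add (integrable_of_continuous_compact (by fun_prop))
      (integrable_of_continuous_compact (by fun_prop)), two_mul]
    exact add_le_add (integral_supNormMulVec_restrictCoords_le μ 𝒜 h𝒜 hc _)
      (integral_supNormMulVec_restrictCoords_le μ 𝒜 h𝒜 hc _)
  have hN : (0 : ℝ) < Fintype.card (Fin n → ℤˣ) := by exact_mod_cast Fintype.card_pos
  refine le_of_mul_le_mul_left ?_ hN
  rw [← integral_const_mul]
  refine (integral_mono (integrable_of_continuous_compact (by fun_prop))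
    (integrable_of_continuous_compact (by fun_prop))
    fun x => card_mul_supNormDiagMulVec_le 𝒜 h𝒜 (boxCoe x)).trans ?_
  rw [integral_finsetSum _ fun s _ => integrable_of_continuous_compact (by fun_prop)]
  refine (Finset.sum_le_sum fun s _ => hs s).trans (le_of_eq ?_)
  simp

end Centered

/-! ### Transfer from the box to arbitrary probability spaces. -/

section Transfer

/-- The law of a vector of independent a.s. bounded variables is that of a product measure on
a box. -/
theorem exists_pi_map_boxCoe_eq {n : ℕ} {Ω : Type*} [MeasurableSpace Ω] (μ : Measure Ω)
    [IsProbabilityMeasure μ] (X : Fin n → Ω → ℝ) {K : ℝ} (hK : 0 ≤ K)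
    (hX : ∀ i, Measurable (X i)) (hind : iIndepFun X μ) (hbd : ∀ i, ∀ᵐ ω ∂μ, |X i ω| ≤ K) :
    ∃ ν : Fin n → Measure (Set.Icc (-K) K), (∀ i, IsProbabilityMeasure (ν i)) ∧
      μ.map (fun ω i => X i ω) = (Measure.pi ν).map boxCoe := by
  have hKK : -K ≤ K := by linarith
  -- Clipping to [-K, K] preserves independence and changes X only on a null set.
  set p : ℝ → Set.Icc (-K) K := Set.projIcc (-K) K hKK
  have hp : Measurable p := continuous_projIcc.measurable
  have hY : ∀ i, Measurable (p ∘ X i) := fun i => hp.comp (hX i)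
  refine ⟨fun i => μ.map (p ∘ X i), fun i => Measure.isProbabilityMeasure_map (hY i).aemeasurable,
    ?_⟩
  have h := (iIndepFun_iff_map_fun_eq_pi_map fun i => (hY i).aemeasurable).1
    (hind.comp (fun _ => p) fun _ => hp)
  rw [← h, Measure.map_map continuous_boxCoe.measurable (measurable_pi_lambda _ hY)]
  refine Measure.map_congr ?_
  filter_upwards [ae_all_iff.2 hbd] with ω hω
  ext i
  have := abs_le.1 (hω i)
  simp only [Function.comp_apply, boxCoe, p]
  rw [Set.projIcc_of_mem hKK ⟨this.1, this.2⟩]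

theorem integral_comp_eq_integral_boxCoe {n : ℕ} {Ω : Type*} [MeasurableSpace Ω] {μ : Measure Ω}
    {X : Fin n → Ω → ℝ} {K : ℝ} (hX : ∀ i, Measurable (X i))
    {ν : Fin n → Measure (Set.Icc (-K) K)}
    (h : μ.map (fun ω i => X i ω) = (Measure.pi ν).map boxCoe)
    {F : (Fin n → ℝ) → ℝ} (hF : Continuous F) :
    ∫ ω, F (fun i => X i ω) ∂μ = ∫ x, F (boxCoe x) ∂(Measure.pi ν) := by
  rw [← integral_map (measurable_pi_lambda _ hX).aemeasurable hF.aestronglyMeasurable, h,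
    integral_map continuous_boxCoe.measurable.aemeasurable hF.aestronglyMeasurable]

theorem one_sub_exp_le_measureReal_of_ae_eq_const {Ω : Type*} [MeasurableSpace Ω] (μ : Measure Ω)
    [IsProbabilityMeasure μ] {f : Ω → ℝ} {c r t : ℝ} (hf : ∀ᵐ ω ∂μ, f ω = c) (hr : 0 ≤ r) :
    1 - Real.exp (-t) ≤ μ.real {ω | f ω - ∫ ω', f ω' ∂μ ≤ r} := by
  have hi : ∫ ω', f ω' ∂μ = c := by
    rw [integral_congr_ae (g := fun _ => c) hf]; simp
  have h1 : μ {ω | f ω - ∫ ω', f ω' ∂μ ≤ r} = 1 := by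
    rw [← measure_univ (μ := μ)]
    refine measure_congr (eventuallyEq_univ.2 ?_)
    filter_upwards [hf] with ω hω
    rw [hi, hω]
    linarith
  rw [measureReal_def, h1]
  simp [Real.exp_nonneg]

end Transfer

/-! ### Degenerate cases and the final bounds. -/

section Concentration

theorem supOpNorm_nonneg {n : ℕ} (𝒜 : Finset (Matrix (Fin n) (Fin n) ℝ)) (h𝒜 : 𝒜.Nonempty) :
    0 ≤ supOpNorm 𝒜 h𝒜 := by
  obtain ⟨A, hA⟩ := h𝒜
  exact (norm_nonneg _).trans
    (Finset.le_sup' (fun A => ‖Matrix.toEuclideanCLM (n := Fin n) (𝕜 := ℝ) A‖) hA)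

theorem le_supOpNorm {n : ℕ} (𝒜 : Finset (Matrix (Fin n) (Fin n) ℝ)) (h𝒜 : 𝒜.Nonempty)
    {A : Matrix (Fin n) (Fin n) ℝ} (hA : A ∈ 𝒜) :
    ‖Matrix.toEuclideanCLM (n := Fin n) (𝕜 := ℝ) A‖ ≤ supOpNorm 𝒜 h𝒜 :=
  Finset.le_sup' (fun A => ‖Matrix.toEuclideanCLM (n := Fin n) (𝕜 := ℝ) A‖) hA

theorem nonneg_of_ae_abs_le {Ω : Type*} [MeasurableSpace Ω] {μ : Measure Ω}
    [IsProbabilityMeasure μ] {f : Ω → ℝ} {K : ℝ} (h : ∀ᵐ ω ∂μ, |f ω| ≤ K) : 0 ≤ K := by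
  obtain ⟨ω, hω⟩ := h.exists
  exact (abs_nonneg _).trans hω

/-- Concentration of the supremum of quadratic forms in bounded independent variables. -/
theorem measureReal_supQuadForm_sub_integral_le {n : ℕ} {Ω : Type*} [MeasurableSpace Ω]
    (μ : Measure Ω) [IsProbabilityMeasure μ] (X : Fin n → Ω → ℝ) {K : ℝ} (hK : 0 ≤ K)
    (𝒜 : Finset (Matrix (Fin n) (Fin n) ℝ)) (h𝒜 : 𝒜.Nonempty)
    (g : Matrix (Fin n) (Fin n) ℝ → ℝ) (hX : ∀ i, Measurable (X i)) (hind : iIndepFun X μ)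
    (hbd : ∀ i, ∀ᵐ ω ∂μ, |X i ω| ≤ K) (hsymm : ∀ A ∈ 𝒜, A.IsSymm) {t : ℝ} (ht : 1 ≤ t) :
    1 - Real.exp (-t) ≤
      μ.real {ω | supQuadForm 𝒜 h𝒜 g (fun i => X i ω)
          - ∫ ω', supQuadForm 𝒜 h𝒜 g (fun i => X i ω') ∂μ ≤
        800 * (K * ((∫ ω', supNormMulVec 𝒜 h𝒜 (fun i => X i ω') ∂μ)
            + ∫ ω', supNormDiagMulVec 𝒜 h𝒜 (fun i => X i ω') ∂μ) * Real.sqrt t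
          + K ^ 2 * supOpNorm 𝒜 h𝒜 * t)} := by
  have hL := supOpNorm_nonneg 𝒜 h𝒜
  have hW : 0 ≤ ∫ ω', supNormMulVec 𝒜 h𝒜 (fun i => X i ω') ∂μ :=
    integral_nonneg fun _ => supNormMulVec_nonneg _ _ _
  have hD : 0 ≤ ∫ ω', supNormDiagMulVec 𝒜 h𝒜 (fun i => X i ω') ∂μ :=
    integral_nonneg fun _ => supNormDiagMulVec_nonneg _ _ _
  -- The box estimate needs K and L strictly positive; if either vanishes, Z is almost surely
  -- constant.
  rcases hK.eq_or_lt with hK0 | hK0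
  · refine one_sub_exp_le_measureReal_of_ae_eq_const μ (c := supQuadForm 𝒜 h𝒜 g 0) ?_
      (by positivity)
    filter_upwards [ae_all_iff.2 hbd] with ω hω
    congr 1
    ext i
    exact abs_nonpos_iff.1 ((hω i).trans hK0.ge)
  rcases hL.eq_or_lt with hL0 | hL0
  · refine one_sub_exp_le_measureReal_of_ae_eq_const μ (c := supQuadForm 𝒜 h𝒜 g 0)
      (Eventually.of_forall fun ω => ?_) (by positivity)
    refine Finset.sup'_congr _ rfl fun A hA => ?_
    have h1 := norm_le_zero_iff.1 ((le_supOpNorm 𝒜 h𝒜 hA).trans hL0.ge)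
    have h2 : A = 0 := (map_eq_zero_iff _ Matrix.toEuclideanCLM.injective).1 h1
    simp [h2]
  obtain ⟨ν, hν, hmap⟩ := exists_pi_map_boxCoe_eq μ X hK hX hind hbd
  have hZ := continuous_supQuadForm 𝒜 h𝒜 g
  have hset : ∀ r, μ.real {ω | supQuadForm 𝒜 h𝒜 g (fun i => X i ω) - r ≤
      800 * (K * ((∫ ω', supNormMulVec 𝒜 h𝒜 (fun i => X i ω') ∂μ)
            + ∫ ω', supNormDiagMulVec 𝒜 h𝒜 (fun i => X i ω') ∂μ) * Real.sqrt t
          + K ^ 2 * supOpNorm 𝒜 h𝒜 * t)}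
      = (Measure.pi ν).real {x | supQuadForm 𝒜 h𝒜 g (boxCoe x) - r ≤
      800 * (K * ((∫ ω', supNormMulVec 𝒜 h𝒜 (fun i => X i ω') ∂μ)
            + ∫ ω', supNormDiagMulVec 𝒜 h𝒜 (fun i => X i ω') ∂μ) * Real.sqrt t
          + K ^ 2 * supOpNorm 𝒜 h𝒜 * t)} := by
    intro r
    set b := 800 * (K * ((∫ ω', supNormMulVec 𝒜 h𝒜 (fun i => X i ω') ∂μ)
            + ∫ ω', supNormDiagMulVec 𝒜 h𝒜 (fun i => X i ω') ∂μ) * Real.sqrt t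
          + K ^ 2 * supOpNorm 𝒜 h𝒜 * t)
    have hS : MeasurableSet {y | supQuadForm 𝒜 h𝒜 g y - r ≤ b} :=
      (isClosed_le (by fun_prop) (by fun_prop)).measurableSet
    have h1 := map_measureReal_apply (μ := μ) (measurable_pi_lambda _ hX) hS
    have h2 := map_measureReal_apply (μ := Measure.pi ν) continuous_boxCoe.measurable hS
    rw [hmap] at h1
    exact h1.symm.trans h2
  rw [hset, integral_comp_eq_integral_boxCoe hX hmap hZ,
    integral_comp_eq_integral_boxCoe hX hmap (continuous_supNormMulVec 𝒜 h𝒜),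
    integral_comp_eq_integral_boxCoe hX hmap (continuous_supNormDiagMulVec 𝒜 h𝒜)]
  exact measureReal_supQuadForm_box ν 𝒜 h𝒜 hK0 g hsymm hL0
    (fun A hA => le_supOpNorm 𝒜 h𝒜 hA) ht

theorem integral_supNormDiagMulVec_le_of_centered {n : ℕ} {Ω : Type*} [MeasurableSpace Ω]
    (μ : Measure Ω) [IsProbabilityMeasure μ] (X : Fin n → Ω → ℝ) {K : ℝ} (hK : 0 ≤ K)
    (𝒜 : Finset (Matrix (Fin n) (Fin n) ℝ)) (h𝒜 : 𝒜.Nonempty)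
    (hX : ∀ i, Measurable (X i)) (hind : iIndepFun X μ)
    (hbd : ∀ i, ∀ᵐ ω ∂μ, |X i ω| ≤ K) (hc : ∀ i, ∫ ω, X i ω ∂μ = 0) :
    ∫ ω, supNormDiagMulVec 𝒜 h𝒜 (fun i => X i ω) ∂μ
      ≤ 2 * ∫ ω, supNormMulVec 𝒜 h𝒜 (fun i => X i ω) ∂μ := by
  obtain ⟨ν, hν, hmap⟩ := exists_pi_map_boxCoe_eq μ X hK hX hind hbd
  rw [integral_comp_eq_integral_boxCoe hX hmap (continuous_supNormMulVec 𝒜 h𝒜),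
    integral_comp_eq_integral_boxCoe hX hmap (continuous_supNormDiagMulVec 𝒜 h𝒜)]
  refine integral_supNormDiagMulVec_le ν 𝒜 h𝒜 fun i => ?_
  rw [← hc i, integral_comp_eq_integral_boxCoe hX hmap (F := fun x => x i) (by fun_prop)]
  exact (integral_comp_eval (μ := ν) (i := i) (f := fun s : Set.Icc (-K) K => (s : ℝ))
    (by fun_prop)).symm

/-- With no coordinates the bound |X_i| ≤ K is vacuous and K may be negative, so n = 0 is treated
apart; Z is then deterministic. -/
theorem measureReal_supQuadForm_fin_zero {Ω : Type*} [MeasurableSpace Ω]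
    (μ : Measure Ω) [IsProbabilityMeasure μ] (X : Fin 0 → Ω → ℝ)
    (𝒜 : Finset (Matrix (Fin 0) (Fin 0) ℝ)) (h𝒜 : 𝒜.Nonempty)
    (g : Matrix (Fin 0) (Fin 0) ℝ → ℝ) {r t : ℝ} (hr : 0 ≤ r) :
    1 - Real.exp (-t) ≤ μ.real {ω | supQuadForm 𝒜 h𝒜 g (fun i => X i ω)
          - ∫ ω', supQuadForm 𝒜 h𝒜 g (fun i => X i ω') ∂μ ≤ r} :=
  one_sub_exp_le_measureReal_of_ae_eq_const μ (c := supQuadForm 𝒜 h𝒜 g 0)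
    (Eventually.of_forall fun _ => congrArg _ (Subsingleton.elim _ _)) hr

theorem supNormMulVec_fin_zero (𝒜 : Finset (Matrix (Fin 0) (Fin 0) ℝ)) (h𝒜 : 𝒜.Nonempty)
    (x : Fin 0 → ℝ) : supNormMulVec 𝒜 h𝒜 x = 0 := by
  have h : ∀ A, normMulVec A x = 0 := fun A => by
    rw [normMulVec, Subsingleton.elim (WithLp.toLp 2 (A *ᵥ x)) 0, norm_zero]
  simp [supNormMulVec, h]

theorem supNormDiagMulVec_fin_zero (𝒜 : Finset (Matrix (Fin 0) (Fin 0) ℝ)) (h𝒜 : 𝒜.Nonempty)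
    (x : Fin 0 → ℝ) : supNormDiagMulVec 𝒜 h𝒜 x = 0 := by
  have h : ∀ A, normMulVec A x = 0 := fun A => by
    rw [normMulVec, Subsingleton.elim (WithLp.toLp 2 (A *ᵥ x)) 0, norm_zero]
  simp [supNormDiagMulVec, h]

end Concentration

theorem corollary1 :
    (∃ C : ℝ, 0 < C ∧
      ∀ (n : ℕ) (Ω : Type*) [MeasurableSpace Ω] (μ : Measure Ω) [IsProbabilityMeasure μ]
        (X : Fin n → Ω → ℝ) (K : ℝ)
        (𝒜 : Finset (Matrix (Fin n) (Fin n) ℝ)) (h𝒜 : 𝒜.Nonempty)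
        (g : Matrix (Fin n) (Fin n) ℝ → ℝ),
        (∀ i, Measurable (X i)) →
        iIndepFun X μ →
        (∀ i, ∀ᵐ ω ∂μ, |X i ω| ≤ K) →
        (∀ i, ∫ ω, X i ω ∂μ = 0) →
        (∀ A ∈ 𝒜, A.IsSymm) →
        ∀ t : ℝ, 1 ≤ t →
          1 - Real.exp (-t) ≤
            μ.real {ω | supQuadForm 𝒜 h𝒜 g (fun i => X i ω)
                - ∫ ω', supQuadForm 𝒜 h𝒜 g (fun i => X i ω') ∂μ ≤
              C * (K * (∫ ω', supNormMulVec 𝒜 h𝒜 (fun i => X i ω') ∂μ) * Real.sqrt t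
                + K ^ 2 * supOpNorm 𝒜 h𝒜 * t)}) ∧
    (∃ C : ℝ, 0 < C ∧
      ∀ (n : ℕ) (Ω : Type*) [MeasurableSpace Ω] (μ : Measure Ω) [IsProbabilityMeasure μ]
        (X : Fin n → Ω → ℝ) (K : ℝ)
        (𝒜 : Finset (Matrix (Fin n) (Fin n) ℝ)) (h𝒜 : 𝒜.Nonempty)
        (g : Matrix (Fin n) (Fin n) ℝ → ℝ),
        (∀ i, Measurable (X i)) →
        iIndepFun X μ →
        (∀ i, ∀ᵐ ω ∂μ, |X i ω| ≤ K) →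
        (∀ A ∈ 𝒜, A.IsSymm) →
        ∀ t : ℝ, 1 ≤ t →
          1 - Real.exp (-t) ≤
            μ.real {ω | supQuadForm 𝒜 h𝒜 g (fun i => X i ω)
                - ∫ ω', supQuadForm 𝒜 h𝒜 g (fun i => X i ω') ∂μ ≤
              C * (K * ((∫ ω', supNormMulVec 𝒜 h𝒜 (fun i => X i ω') ∂μ)
                  + ∫ ω', supNormDiagMulVec 𝒜 h𝒜 (fun i => X i ω') ∂μ) * Real.sqrt t
                + K ^ 2 * supOpNorm 𝒜 h𝒜 * t)}) := by
  constructor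
  -- 2400 = 800·(1 + 2), the 2 coming from the comparison of the diagonal term with the full one.
  · refine ⟨2400, by norm_num, ?_⟩
    intro n Ω _ μ _ X K 𝒜 h𝒜 g hX hind hbd hc hsymm t ht
    have hL := supOpNorm_nonneg 𝒜 h𝒜
    rcases n.eq_zero_or_pos with rfl | hn
    · refine measureReal_supQuadForm_fin_zero μ X 𝒜 h𝒜 g ?_
      simp only [supNormMulVec_fin_zero, integral_zero, mul_zero, zero_mul, zero_add]
      positivity
    have hK : 0 ≤ K := nonneg_of_ae_abs_le (hbd ⟨0, hn⟩)
    refine (measureReal_supQuadForm_sub_integral_le μ X hK 𝒜 h𝒜 g hX hind hbd hsymm ht).trans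
      (measureReal_mono fun ω hω => ?_)
    rw [Set.mem_ofPred_eq] at hω ⊢
    refine hω.trans ?_
    have hD := integral_supNormDiagMulVec_le_of_centered μ X hK 𝒜 h𝒜 hX hind hbd hc
    have h1 := mul_le_mul_of_nonneg_right (mul_le_mul_of_nonneg_left hD hK) (Real.sqrt_nonneg t)
    have h2 : 0 ≤ K ^ 2 * supOpNorm 𝒜 h𝒜 * t := by positivity
    linarith
  · refine ⟨800, by norm_num, ?_⟩
    intro n Ω _ μ _ X K 𝒜 h𝒜 g hX hind hbd hsymm t ht
    have hL := supOpNorm_nonneg 𝒜 h𝒜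
    rcases n.eq_zero_or_pos with rfl | hn
    · refine measureReal_supQuadForm_fin_zero μ X 𝒜 h𝒜 g ?_
      simp only [supNormMulVec_fin_zero, supNormDiagMulVec_fin_zero, integral_zero, mul_zero,
        zero_mul, zero_add]
      positivity
    exact measureReal_supQuadForm_sub_integral_le μ X (nonneg_of_ae_abs_le (hbd ⟨0, hn⟩)) 𝒜 h𝒜 g
      hX hind hbd hsymm ht
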